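/- Let $G$ be a countable discrete group, $(X,\mu)$ a standard probability space on which $G$ acts by measure-preserving transformations, and $\alpha_s(f)(x)=f(s^{-1}x)$ the induced action on the complex space $L^\infty(X,\mu)$. Let $\Sigma=\{\sigma_i:G\to\mathrm{Sym}(d_i)\}_{i=1}^\infty$ be a sofic approximation sequence for $G$, i.e. $d_i\geq 1$, $d_i\to\infty$, $\frac1{d_i}|\{k:\sigma_{i,st}(k)=\sigma_{i,s}\sigma_{i,t}(k)\}|\to1$ for all $s,t\in G$, and $\frac1{d_i}|\{k:\sigma_{i,s}(k)\ne\sigma_{i,t}(k)\}|\to1$ for all distinct $s,t\in G$. Notation. On $\mathbb C^d$ put $\zeta(v)=\frac1d\sum_k v_k$, $\|v\|_2=(\frac1d\sum_k|v_k|^2)^{1/2}$, and $\sigma_s(v)=v\circ\sigma_s^{-1}$ for $\sigma:G\to\mathrm{Sym}(d)$. Let $\mathcal S=\{p_n\}_{n\ge1}$ be a sequence in the unit ball of the space $L^\infty_{\mathbb R}(X,\mu)$ of real-valued elements of $L^\infty(X,\mu)$. For a nonempty finite $F\subseteq G$, $m\in\mathbb N$, $\delta>0$ and $\sigma:G\to\mathrm{Sym}(d)$,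 let $\mathrm{UP}_\mu(\mathcal S,F,m,\delta,\sigma)$ be the set of unital positive linear maps $\varphi:L^\infty(X,\mu)\to\mathbb C^d$ such that for all $1\le j\le m$, $f_1,\dots,f_j\in\{p_1,\dots,p_m\}$ and $s_1,\dots,s_j\in F$ (i) $\|\varphi(\alpha_{s_1}(f_1)\cdots\alpha_{s_j}(f_j))-\varphi(\alpha_{s_1}(f_1))\cdots\varphi(\alpha_{s_j}(f_j))\|_2<\delta$, (ii) $|\zeta(\varphi(\alpha_{s_1}(f_1)\cdots\alpha_{s_j}(f_j)))-\int\alpha_{s_1}(f_1)\cdots\alpha_{s_j}(f_j)\,d\mu|<\delta$, and (iii) $\|\varphi(\alpha_s(f))-\sigma_s(\varphi(f))\|_2<\delta$ for all $s\in F$ and $f\in\{p_1,\dots,p_m\}$. Let $\rho_{\mathcal S}(\varphi,\psi)=\sum_{n\ge1}2^{-n}\|\varphi(p_n)-\psi(p_n)\|_2$, let $N_\varepsilon(Y,\rho)$ be the maximal cardinality of a finite subset of $Y$ whose distinct points are at $\rho$-distance $>\varepsilon$, and define, in $[-\infty,\infty]$ with $\log0=-\infty$, $$h_{\Sigma,\mu}(\mathcal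 S)=\sup_{\varepsilon>0}\inf_F\inf_{m\in\mathbb N}\inf_{\delta>0}\limsup_{i\to\infty}\frac1{d_i}\log N_\varepsilon(\mathrm{UP}_\mu(\mathcal S,F,m,\delta,\sigma_i),\rho_{\mathcal S}),$$ where $F$ ranges over the nonempty finite subsets of $G$. A sequence is dynamically generating if it is contained in no proper $G$-invariant von Neumann subalgebra (weak-* closed unital $*$-subalgebra) of $L^\infty(X,\mu)$. Theorem. If $\mathcal S$ and $\mathcal T$ are dynamically generating sequences in the unit ball of $L^\infty_{\mathbb R}(X,\mu)$, then $h_{\Sigma,\mu}(\mathcal T)=h_{\Sigma,\mu}(\mathcal S)$. Moreover such sequences exist; consequently the measure entropy $h_{\Sigma,\mu}(X,G)$, the common value of $h_{\Sigma,\mu}(\mathcal S)$ over all dynamically generating sequences $\mathcal S$ in the unit ball of $L^\infty_{\mathbb R}(X,\mu)$, is well defined. -/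

import Mathlib

open MeasureTheory Filter Topology
open scoped ENNReal ComplexOrder

namespace SoficEntropy

noncomputable section

section LInfty

/-- The space `L^∞(X, μ)` of complex-valued essentially bounded functions modulo null sets, with
the essential supremum norm. -/
abbrev LInfty {X : Type*} [MeasurableSpace X] (μ : Measure X) : Type _ := Lp ℂ ∞ μ

variable {X : Type*} [MeasurableSpace X] {μ : Measure X}

/-- Pointwise multiplication on `L^∞(X, μ)`. -/
instance instMulLInfty : Mul (LInfty μ) where
  mul f g := MemLp.toLp (fun x => f x * g x) ((Lp.memLp g).mul (Lp.memLp f))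

/-- The constant function `1`. -/
instance instOneLInfty : One (LInfty μ) where
  one := MemLp.toLp (fun _ => (1 : ℂ)) (memLp_top_const 1)

theorem coeFn_mul (f g : LInfty μ) : ⇑(f * g) =ᵐ[μ] fun x => f x * g x :=
  MemLp.coeFn_toLp _

theorem coeFn_one : ⇑(1 : LInfty μ) =ᵐ[μ] fun _ => (1 : ℂ) :=
  MemLp.coeFn_toLp _

theorem coeFn_star (f : LInfty μ) : ⇑(star f) =ᵐ[μ] fun x => star (f x) :=
  AEEqFun.coeFn_star f.1

theorem mul_comm_LInfty (f g : LInfty μ) : f * g = g * f := by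
  ext1
  filter_upwards [coeFn_mul f g, coeFn_mul g f] with x h1 h2
  rw [h1, h2, mul_comm]

theorem one_mul_LInfty (f : LInfty μ) : 1 * f = f := by
  ext1
  filter_upwards [coeFn_mul 1 f, coeFn_one (μ := μ)] with x h1 h2
  rw [h1, h2, one_mul]

theorem mul_assoc_LInfty (f g h : LInfty μ) : f * g * h = f * (g * h) := by
  ext1
  filter_upwards [coeFn_mul (f * g) h, coeFn_mul f g, coeFn_mul f (g * h), coeFn_mul g h]
    with x h1 h2 h3 h4
  rw [h1, h2, h3, h4, mul_assoc]

theorem mul_add_LInfty (f g h : LInfty μ) : f * (g + h) = f * g + f * h := by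
  ext1
  filter_upwards [coeFn_mul f (g + h), Lp.coeFn_add g h, Lp.coeFn_add (f * g) (f * h),
    coeFn_mul f g, coeFn_mul f h] with x h1 h2 h3 h4 h5
  rw [h1, h2, h3, Pi.add_apply, Pi.add_apply, h4, h5, mul_add]

theorem mul_zero_LInfty (f : LInfty μ) : f * 0 = 0 := by
  ext1
  filter_upwards [coeFn_mul f 0, Lp.coeFn_zero ℂ ∞ μ] with x h1 h2
  rw [h1, h2, Pi.zero_apply, mul_zero]

theorem smul_mul_LInfty (c : ℂ) (f g : LInfty μ) : c • f * g = c • (f * g) := by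
  ext1
  filter_upwards [coeFn_mul (c • f) g, Lp.coeFn_smul c f, Lp.coeFn_smul c (f * g),
    coeFn_mul f g] with x h1 h2 h3 h4
  rw [h1, h2, h3, Pi.smul_apply, Pi.smul_apply, h4, smul_eq_mul, smul_eq_mul, mul_assoc]

instance instCommRingLInfty : CommRing (LInfty μ) where
  __ := (inferInstance : AddCommGroup (LInfty μ))
  mul := (· * ·)
  one := 1
  mul_assoc := mul_assoc_LInfty
  one_mul := one_mul_LInfty
  mul_one f := by rw [mul_comm_LInfty, one_mul_LInfty]
  mul_comm := mul_comm_LInfty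
  left_distrib := mul_add_LInfty
  right_distrib f g h := by
    rw [mul_comm_LInfty, mul_add_LInfty, mul_comm_LInfty h f, mul_comm_LInfty h g]
  zero_mul f := by rw [mul_comm_LInfty, mul_zero_LInfty]
  mul_zero := mul_zero_LInfty

instance instAlgebraLInfty : Algebra ℂ (LInfty μ) :=
  Algebra.ofModule smul_mul_LInfty fun c f g => by
    rw [mul_comm f (c • g), smul_mul_LInfty, mul_comm g f]

instance instStarRingLInfty : StarRing (LInfty μ) where
  star_mul f g := by
    ext1
    filter_upwards [coeFn_star (f * g), coeFn_mul f g, coeFn_mul (star g) (star f),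
      coeFn_star f, coeFn_star g] with x h1 h2 h3 h4 h5
    rw [h1, h2, h3, h4, h5, star_mul]
  star_add f g := by
    ext1
    filter_upwards [coeFn_star (f + g), Lp.coeFn_add f g, Lp.coeFn_add (star f) (star g),
      coeFn_star f, coeFn_star g] with x h1 h2 h3 h4 h5
    rw [h1, h2, h3, Pi.add_apply, Pi.add_apply, h4, h5, star_add]

instance instStarModuleLInfty : StarModule ℂ (LInfty μ) where
  star_smul c f := by
    ext1
    filter_upwards [coeFn_star (c • f), Lp.coeFn_smul c f, Lp.coeFn_smul (star c) (star f),
      coeFn_star f] with x h1 h2 h3 h4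
    rw [h1, h2, h3, Pi.smul_apply, Pi.smul_apply, h4, star_smul]

/-- The weak-* topology on `L^∞(X, μ)`, i.e. the topology of pointwise convergence on `L^1(X, μ)`
for the pairing `(f, g) ↦ ∫ f g dμ`. -/
@[reducible] def weakStarTopology (μ : Measure X) : TopologicalSpace (LInfty μ) :=
  TopologicalSpace.induced (fun f (g : Lp ℂ 1 μ) => ∫ x, f x * g x ∂μ) inferInstance

/-- A von Neumann subalgebra of `L^∞(X, μ)`: a weak-* closed unital *-subalgebra. -/
def IsVonNeumannSubalgebra (A : StarSubalgebra ℂ (LInfty μ)) : Prop :=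
  IsClosed[weakStarTopology μ] (A : Set (LInfty μ))

/-- Sequences in the unit ball of `L^∞_ℝ(X, μ)`. -/
def IsRealUnitBallSeq (p : ℕ → LInfty μ) : Prop :=
  ∀ n, ‖p n‖ ≤ 1 ∧ ∀ᵐ x ∂μ, (p n x).im = 0

end LInfty

section Action

variable {G X : Type*} [Group G] [MulAction G X] [MeasurableSpace X] [MeasurableConstSMul G X]
  {μ : Measure X} [SMulInvariantMeasure G X μ]

/-- The induced action `α_s(f)(x) = f(s⁻¹ x)` on `L^∞(X, μ)`. -/
def alpha (s : G) (f : LInfty μ) : LInfty μ :=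
  Lp.compMeasurePreserving (fun x : X => s⁻¹ • x) (measurePreserving_smul s⁻¹ μ) f

variable (G) in
/-- A set is dynamically generating if it lies in no proper `G`-invariant von Neumann
subalgebra of `L^∞(X, μ)`. -/
def IsDynamicallyGenerating (Ω : Set (LInfty μ)) : Prop :=
  ∀ A : StarSubalgebra ℂ (LInfty μ), IsVonNeumannSubalgebra A →
    (∀ s : G, ∀ f ∈ A, alpha s f ∈ A) → Ω ⊆ A → A = ⊤

end Action

section Sofic

/-- A sofic approximation sequence `Σ = {σ_i : G → Sym(d_i)}` for `G`. -/
structure IsSoficApproximation {G : Type*} [Group G] (d : ℕ → ℕ)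
    (σ : ∀ i, G → Equiv.Perm (Fin (d i))) : Prop where
  pos : ∀ i, 0 < d i
  asymptotically_mul : ∀ s t : G,
    Tendsto (fun i => (1 / (d i : ℝ)) *
      (Finset.univ.filter fun k => σ i (s * t) k = σ i s (σ i t k)).card) atTop (𝓝 1)
  asymptotically_free : ∀ s t : G, s ≠ t →
    Tendsto (fun i => (1 / (d i : ℝ)) *
      (Finset.univ.filter fun k => σ i s k ≠ σ i t k).card) atTop (𝓝 1)
  tendsto_card : Tendsto d atTop atTop

/-- The normalized `ℓ²`-norm `(d⁻¹ ∑ |v_k|²)^{1/2}` on `ℂ^d`. -/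
def norm2 {d : ℕ} (v : Fin d → ℂ) : ℝ := Real.sqrt ((1 / (d : ℝ)) * ∑ k, ‖v k‖ ^ 2)

/-- The state on `ℂ^d` given by the uniform probability measure. -/
def zeta {d : ℕ} (v : Fin d → ℂ) : ℂ := (1 / (d : ℂ)) * ∑ k, v k

end Sofic

section Entropy

/-- `N_ε(Y, ρ)`: the maximal cardinality of a finite `ε`-separated subset of `Y` (`0` if `Y` is
empty, `⊤` if there are arbitrarily large ones). -/
def sepNumber {E : Type*} (ε : ℝ) (Y : Set E) (ρ : E → E → ℝ) : ℕ∞ :=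
  ⨆ (L : Finset E) (_ : (L : Set E) ⊆ Y ∧ (L : Set E).Pairwise fun x y => ε < ρ x y),
    (L.card : ℕ∞)

variable {G X : Type*} [Group G] [MulAction G X] [MeasurableSpace X] [MeasurableConstSMul G X]
  {μ : Measure X} [SMulInvariantMeasure G X μ]

/-- Unital positive linear maps `L^∞(X, μ) → ℂ^d`. -/
structure IsUnitalPositive {d : ℕ} (φ : LInfty μ →ₗ[ℂ] (Fin d → ℂ)) : Prop where
  map_one : φ 1 = 1
  nonneg : ∀ f : LInfty μ, (∀ᵐ x ∂μ, 0 ≤ f x) → 0 ≤ φ f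

/-- The pseudometric `ρ_𝒮(φ, ψ) = ∑_{n ≥ 1} 2^{-n} ‖φ(p_n) - ψ(p_n)‖₂`; the member `p_{n+1}` of
the sequence `𝒮` is `p n`. -/
def rho {d : ℕ} (p : ℕ → LInfty μ) (φ ψ : LInfty μ →ₗ[ℂ] (Fin d → ℂ)) : ℝ :=
  ∑' n : ℕ, (1 / 2 ^ (n + 1)) * norm2 (φ (p n) - ψ (p n))

/-- The set `UP_μ(𝒮, F, m, δ, σ)`. A product `α_{s_1}(f_1) ⋯ α_{s_j}(f_j)` with
`f_k ∈ {p_1, …, p_m}` and `s_k ∈ F` is indexed by `a : Fin j → Fin m` and `s : Fin j → F`. -/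
structure IsUP {d : ℕ} (p : ℕ → LInfty μ) (F : Finset G) (m : ℕ) (δ : ℝ)
    (σ : G → Equiv.Perm (Fin d)) (φ : LInfty μ →ₗ[ℂ] (Fin d → ℂ)) : Prop where
  unital_positive : IsUnitalPositive φ
  approx_mul : ∀ j : ℕ, 1 ≤ j → j ≤ m → ∀ (a : Fin j → Fin m) (s : Fin j → F),
    norm2 (φ (∏ k, alpha (s k : G) (p (a k))) - ∏ k, φ (alpha (s k : G) (p (a k)))) < δ
  approx_state : ∀ j : ℕ, 1 ≤ j → j ≤ m → ∀ (a : Fin j → Fin m) (s : Fin j → F),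
    ‖zeta (φ (∏ k, alpha (s k : G) (p (a k))))
      - ∫ x, (∏ k, alpha (s k : G) (p (a k)) : LInfty μ) x ∂μ‖ < δ
  approx_equivariant : ∀ s ∈ F, ∀ n : Fin m,
    norm2 (φ (alpha s (p n)) - fun k => φ (p n) ((σ s)⁻¹ k)) < δ

variable {d : ℕ → ℕ}

/-- `h^ε_{Σ,μ}(𝒮, F, m, δ) = limsup_i d_i⁻¹ log N_ε(UP_μ(𝒮, F, m, δ, σ_i), ρ_𝒮)`, with
`log 0 = -∞`. -/
def entropyLocal (σ : ∀ i, G → Equiv.Perm (Fin (d i))) (p : ℕ → LInfty μ) (ε : ℝ)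
    (F : Finset G) (m : ℕ) (δ : ℝ) : EReal :=
  limsup (fun i => ENNReal.log
    (sepNumber ε {φ | IsUP p F m δ (σ i) φ} (rho p) : ℝ≥0∞) / ((d i : ℝ) : EReal)) atTop

/-- `h^ε_{Σ,μ}(𝒮)`: the infimum over nonempty finite `F ⊆ G`, `m ≥ 1` and `δ > 0`. -/
def entropyEps (σ : ∀ i, G → Equiv.Perm (Fin (d i))) (p : ℕ → LInfty μ) (ε : ℝ) : EReal :=
  ⨅ (F : Finset G) (_ : F.Nonempty), ⨅ (m : ℕ) (_ : 1 ≤ m), ⨅ (δ : ℝ) (_ : 0 < δ),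
    entropyLocal σ p ε F m δ

/-- `h_{Σ,μ}(𝒮) = sup_{ε > 0} h^ε_{Σ,μ}(𝒮)`. -/
def entropy (σ : ∀ i, G → Equiv.Perm (Fin (d i))) (p : ℕ → LInfty μ) : EReal :=
  ⨆ (ε : ℝ) (_ : 0 < ε), entropyEps σ p ε

/-- `h` is the measure entropy `h_{Σ,μ}(X, G)`: dynamically generating sequences in the unit ball
of `L^∞_ℝ(X, μ)` exist, and `h` is the common value of their entropies. -/
def IsGlobalEntropy (μ : Measure X) [SMulInvariantMeasure G X μ]
    (σ : ∀ i, G → Equiv.Perm (Fin (d i))) (h : EReal) : Prop :=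
  (∃ p : ℕ → LInfty μ, IsRealUnitBallSeq p ∧ IsDynamicallyGenerating G (Set.range p)) ∧
    ∀ p : ℕ → LInfty μ, IsRealUnitBallSeq p → IsDynamicallyGenerating G (Set.range p) →
      entropy σ p = h

end Entropy

end

end SoficEntropy

/-!
The two inequalities between `entropy σ p` and `entropy σ q` are symmetric, so it suffices to
compare the `ε`-separated sets of `UP_μ(p, …)` with those of `UP_μ(q, …)`. An element `φ` of
`UP_μ(p, …)` need not belong to `UP_μ(q, …)`: it is only controlled on the algebra `genAlg G p`
generated by the translates of `p`, and may behave singularly on other elements of `L^∞(X, μ)`.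
It is therefore replaced by `φ ∘ θ`, where `θ` is a unital positive map of `L^∞(X, μ)` into
`genAlg G p` that is `L²`-close to the identity on a prescribed finite set.

Such maps `θ` exist (`exists_isSmoothing_near`) because `genAlg G p` is `L²`-dense
(`exists_genAlg_near`): the elements of `L^∞(X, μ)` in the `L²`-closure of the algebra form a
`G`-invariant von Neumann subalgebra. By the Weierstrass theorem indicator functions are
`L²`-limits of elements of the algebra with values in `[0, 1]`, which yields partitions of unity
in the algebra that approximate measurable partitions.

On `genAlg G p` the elements of `UP_μ(p, F, m, δ, σ_i)` are asymptotically multiplicative, state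
preserving and equivariant, and hence, by the Kadison–Schwarz inequality, `L²`-contractive
(`isNull_mul`, `tendsto_zeta`, `isNull_equivariant`, `eventually_norm2_lt`). These limits are taken
along the filter `upFilter σ p`, which encodes "for some `F`, `m`, `δ`, all large `i` and all
`φ ∈ UP_μ(p, F, m, δ, σ_i)`". They show that `φ ∘ θ` lies in `UP_μ(q, F', m', δ', σ_i)`
(`exists_isSmoothing_isUP`). That `φ ↦ φ ∘ θ` keeps separated maps apart is seen by approximating
the first members of `p` by elements `r_n` of `genAlg G q`: maps in `UP_μ(q, …)` that are close on
`q` are close on `r_n` (`isNull_pair_sub`), while `φ(θ(r_n))` is close to `φ(p_n)`.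

Generating sequences exist since the Borel structure of `X` is countably generated
(`exists_generating_sequence`).
-/

namespace SoficEntropy

noncomputable section

/-! ### `L^∞(X, μ)` and its `L²`-norm -/

section LInftyBasics

variable {X : Type*} [MeasurableSpace X] {μ : Measure X}

theorem ae_norm_le_norm (f : LInfty μ) : ∀ᵐ x ∂μ, ‖f x‖ ≤ ‖f‖ := by
  have h := ae_le_eLpNormEssSup (f := f) (μ := μ)
  filter_upwards [h] with x hx
  rw [Lp.norm_def, eLpNorm_exponent_top, ← toReal_enorm]
  refine ENNReal.toReal_mono ?_ hx
  rw [← eLpNorm_exponent_top]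
  exact (Lp.memLp f).2.ne

theorem norm_le_of_ae_norm_le {f : LInfty μ} {C : ℝ} (hC : 0 ≤ C) (h : ∀ᵐ x ∂μ, ‖f x‖ ≤ C) :
    ‖f‖ ≤ C := by
  rw [Lp.norm_def, eLpNorm_exponent_top]
  exact ENNReal.toReal_le_of_le_ofReal hC (eLpNormEssSup_le_of_ae_bound h)

theorem norm_mul_le_LInfty (f g : LInfty μ) : ‖f * g‖ ≤ ‖f‖ * ‖g‖ := by
  refine norm_le_of_ae_norm_le (by positivity) ?_
  filter_upwards [coeFn_mul f g, ae_norm_le_norm f, ae_norm_le_norm g] with x h1 h2 h3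
  rw [h1, norm_mul]
  gcongr

theorem norm_one_le_LInfty : ‖(1 : LInfty μ)‖ ≤ 1 := by
  refine norm_le_of_ae_norm_le zero_le_one ?_
  filter_upwards [coeFn_one (μ := μ)] with x h1
  rw [h1, norm_one]

theorem norm_prod_le_one {ι : Type*} (s : Finset ι) (f : ι → LInfty μ) (hf : ∀ i ∈ s, ‖f i‖ ≤ 1) :
    ‖∏ i ∈ s, f i‖ ≤ 1 := by
  classical
  induction s using Finset.induction_on with
  | empty => simpa using norm_one_le_LInfty
  | insert i s hi ih =>
    rw [Finset.prod_insert hi]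
    refine (norm_mul_le_LInfty _ _).trans ?_
    exact mul_le_one₀ (hf i (by simp)) (norm_nonneg _)
      (ih fun j hj => hf j (Finset.mem_insert_of_mem hj))

theorem coeFn_algebraMap (c : ℂ) : ⇑(algebraMap ℂ (LInfty μ) c) =ᵐ[μ] fun _ => c := by
  rw [Algebra.algebraMap_eq_smul_one]
  filter_upwards [Lp.coeFn_smul c (1 : LInfty μ), coeFn_one (μ := μ)] with x h1 h2
  rw [h1, Pi.smul_apply, h2, smul_eq_mul, mul_one]

variable (μ) in
/-- The inclusion `L^∞(X, μ) → L²(X, μ)`; the `L²`-norm of `f : LInfty μ` is `‖toL2 μ f‖`. -/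
def toL2 [IsFiniteMeasure μ] : LInfty μ →ₗ[ℂ] Lp ℂ 2 μ where
  toFun f := MemLp.toLp f ((Lp.memLp f).mono_exponent le_top)
  map_add' f g := by
    ext1
    filter_upwards [MemLp.coeFn_toLp ((Lp.memLp (f + g)).mono_exponent (p := 2) le_top),
      MemLp.coeFn_toLp ((Lp.memLp f).mono_exponent (p := 2) le_top),
      MemLp.coeFn_toLp ((Lp.memLp g).mono_exponent (p := 2) le_top), Lp.coeFn_add f g,
      Lp.coeFn_add (MemLp.toLp f ((Lp.memLp f).mono_exponent (p := 2) le_top))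
        (MemLp.toLp g ((Lp.memLp g).mono_exponent (p := 2) le_top))] with x h1 h2 h3 h4 h5
    rw [h1, h4, h5, Pi.add_apply, Pi.add_apply, h2, h3]
  map_smul' c f := by
    ext1
    filter_upwards [MemLp.coeFn_toLp ((Lp.memLp (c • f)).mono_exponent (p := 2) le_top),
      MemLp.coeFn_toLp ((Lp.memLp f).mono_exponent (p := 2) le_top), Lp.coeFn_smul c f,
      Lp.coeFn_smul c (MemLp.toLp f ((Lp.memLp f).mono_exponent (p := 2) le_top))]
      with x h1 h2 h3 h4
    rw [h1, h3, RingHom.id_apply, h4, Pi.smul_apply, Pi.smul_apply, h2]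

section Finite

variable [IsFiniteMeasure μ]

theorem coeFn_toL2 (f : LInfty μ) : ⇑(toL2 μ f) =ᵐ[μ] f :=
  MemLp.coeFn_toLp ((Lp.memLp f).mono_exponent (p := 2) le_top)

theorem norm_toL2_mul_le (f g : LInfty μ) : ‖toL2 μ (f * g)‖ ≤ ‖f‖ * ‖toL2 μ g‖ := by
  refine Lp.norm_le_mul_norm_of_ae_le_mul ?_
  filter_upwards [coeFn_toL2 (f * g), coeFn_toL2 g, coeFn_mul f g, ae_norm_le_norm f]
    with x h1 h2 h3 h4
  rw [h1, h2, h3, norm_mul]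
  gcongr

theorem norm_toL2_le_of_ae_le {f g : LInfty μ} (h : ∀ᵐ x ∂μ, ‖f x‖ ≤ ‖g x‖) :
    ‖toL2 μ f‖ ≤ ‖toL2 μ g‖ := by
  refine Lp.norm_le_norm_of_ae_le ?_
  filter_upwards [coeFn_toL2 f, coeFn_toL2 g, h] with x h1 h2 h3
  rwa [h1, h2]

theorem norm_toL2_star (f : LInfty μ) : ‖toL2 μ (star f)‖ = ‖toL2 μ f‖ := by
  apply le_antisymm <;> refine norm_toL2_le_of_ae_le ?_ <;>
    filter_upwards [coeFn_star f] with x h1 <;> rw [h1, norm_star]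

end Finite

section Prob

variable [IsProbabilityMeasure μ]

theorem norm_toL2_le_of_ae_norm_le {f : LInfty μ} {C : ℝ} (hC : 0 ≤ C)
    (h : ∀ᵐ x ∂μ, ‖f x‖ ≤ C) : ‖toL2 μ f‖ ≤ C := by
  have := Lp.norm_le_of_ae_bound (f := toL2 μ f) hC
    (by filter_upwards [coeFn_toL2 f, h] with x h1 h2; rwa [h1])
  simpa [measureUnivNNReal] using this

theorem norm_toL2_le (f : LInfty μ) : ‖toL2 μ f‖ ≤ ‖f‖ :=
  norm_toL2_le_of_ae_norm_le (norm_nonneg _) (ae_norm_le_norm f)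

theorem integrable_LInfty (f : LInfty μ) : Integrable f μ :=
  (Lp.memLp f).integrable le_top

theorem integral_star_mul (f g : LInfty μ) :
    ∫ x, (star f * g) x ∂μ = inner ℂ (toL2 μ f) (toL2 μ g) := by
  rw [L2.inner_def]
  refine integral_congr_ae ?_
  filter_upwards [coeFn_mul (star f) g, coeFn_star f, coeFn_toL2 f, coeFn_toL2 g]
    with x h1 h2 h3 h4
  rw [h1, h2, h3, h4, RCLike.inner_apply, mul_comm]
  rfl

theorem integral_star_mul_self (f : LInfty μ) :
    ∫ x, (star f * f) x ∂μ = ((‖toL2 μ f‖ ^ 2 : ℝ) : ℂ) := by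
  rw [integral_star_mul, inner_self_eq_norm_sq_to_K]
  norm_cast

theorem norm_integral_le (f : LInfty μ) : ‖∫ x, f x ∂μ‖ ≤ ‖toL2 μ f‖ := by
  have h := integral_star_mul (1 : LInfty μ) f
  rw [star_one, one_mul] at h
  rw [h]
  refine (norm_inner_le_norm _ _).trans ?_
  have : ‖toL2 μ (1 : LInfty μ)‖ ≤ 1 := (norm_toL2_le _).trans norm_one_le_LInfty
  nlinarith [norm_nonneg (toL2 μ f)]

/-- The pointwise triangle inequality `|f| ≤ C + |g|` passes to `L²`-norms. -/
theorem norm_toL2_le_add {f g : LInfty μ} {C : ℝ} (hC : 0 ≤ C)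
    (h : ∀ᵐ x ∂μ, ‖f x‖ ≤ C + ‖g x‖) : ‖toL2 μ f‖ ≤ C + ‖toL2 μ g‖ := by
  have hg : MemLp (fun x => ‖g x‖) 2 μ := ((Lp.memLp g).mono_exponent le_top).norm
  have hc : MemLp (fun _ : X => C) 2 μ := memLp_const C
  have h1 : ‖toL2 μ f‖ ≤ ‖hc.toLp + hg.toLp‖ := by
    refine Lp.norm_le_norm_of_ae_le ?_
    filter_upwards [h, coeFn_toL2 f, Lp.coeFn_add hc.toLp hg.toLp, hc.coeFn_toLp, hg.coeFn_toLp]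
      with x h1 h2 h3 h4 h5
    rw [h2, h3, Pi.add_apply, h4, h5]
    exact h1.trans (le_abs_self _)
  refine h1.trans ((norm_add_le _ _).trans (add_le_add ?_ ?_))
  · have := Lp.norm_le_of_ae_bound (f := hc.toLp) hC
      (by filter_upwards [hc.coeFn_toLp] with x h1; rw [h1, Real.norm_of_nonneg hC])
    simpa [measureUnivNNReal] using this
  · refine Lp.norm_le_norm_of_ae_le ?_
    filter_upwards [coeFn_toL2 g, hg.coeFn_toLp] with x h1 h2
    rw [h1, h2, norm_norm]

end Prob

end LInftyBasics

/-! ### The induced action -/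

section AlphaBasics

variable {G X : Type*} [Group G] [MulAction G X] [MeasurableSpace X] [MeasurableConstSMul G X]
  {μ : Measure X} [SMulInvariantMeasure G X μ]

theorem coeFn_alpha (s : G) (f : LInfty μ) : ⇑(alpha s f) =ᵐ[μ] fun x => f (s⁻¹ • x) :=
  Lp.coeFn_compMeasurePreserving f (measurePreserving_smul s⁻¹ μ)

theorem ae_smul {p : X → Prop} (s : G) (h : ∀ᵐ x ∂μ, p x) : ∀ᵐ x ∂μ, p (s • x) :=
  (measurePreserving_smul s μ).quasiMeasurePreserving.ae h

/-- The action of `s : G` on `L^∞(X, μ)` as an algebra homomorphism. -/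
def alphaHom (s : G) : LInfty μ →ₐ[ℂ] LInfty μ where
  toFun := alpha s
  map_one' := by
    ext1
    filter_upwards [coeFn_alpha s (1 : LInfty μ), coeFn_one (μ := μ),
      ae_smul s⁻¹ (coeFn_one (μ := μ))] with x h1 h2 h3
    rw [h1, h2, h3]
  map_mul' f g := by
    ext1
    filter_upwards [coeFn_alpha s (f * g), coeFn_alpha s f, coeFn_alpha s g,
      coeFn_mul (alpha s f) (alpha s g), ae_smul s⁻¹ (coeFn_mul f g)] with x h1 h2 h3 h4 h5
    rw [h1, h4, h2, h3, h5]
  map_zero' := by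
    ext1
    filter_upwards [coeFn_alpha s (0 : LInfty μ), Lp.coeFn_zero ℂ ∞ μ,
      ae_smul s⁻¹ (Lp.coeFn_zero ℂ ∞ μ)] with x h1 h2 h3
    rw [h1, h2, h3]
    rfl
  map_add' f g := by
    ext1
    filter_upwards [coeFn_alpha s (f + g), coeFn_alpha s f, coeFn_alpha s g,
      Lp.coeFn_add (alpha s f) (alpha s g), ae_smul s⁻¹ (Lp.coeFn_add f g)] with x h1 h2 h3 h4 h5
    rw [h1, h4, Pi.add_apply, h2, h3, h5, Pi.add_apply]
  commutes' c := by
    ext1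
    filter_upwards [coeFn_alpha s (algebraMap ℂ (LInfty μ) c), coeFn_algebraMap (μ := μ) c,
      ae_smul s⁻¹ (coeFn_algebraMap (μ := μ) c)] with x h1 h2 h3
    rw [h1, h2, h3]

theorem alphaHom_apply (s : G) (f : LInfty μ) : alphaHom s f = alpha s f := rfl

theorem alpha_star (s : G) (f : LInfty μ) : alpha s (star f) = star (alpha s f) := by
  ext1
  filter_upwards [coeFn_alpha s (star f), coeFn_star (alpha s f), coeFn_alpha s f,
    ae_smul s⁻¹ (coeFn_star f)] with x h1 h2 h3 h4
  rw [h1, h2, h3, h4]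

theorem alpha_alpha (s t : G) (f : LInfty μ) : alpha s (alpha t f) = alpha (s * t) f := by
  ext1
  filter_upwards [coeFn_alpha s (alpha t f), coeFn_alpha (s * t) f,
    ae_smul s⁻¹ (coeFn_alpha t f)] with x h1 h2 h3
  rw [h1, h2, h3, smul_smul, mul_inv_rev]

theorem alpha_one (f : LInfty μ) : alpha (1 : G) f = f := by
  ext1
  filter_upwards [coeFn_alpha (1 : G) f] with x h1
  rw [h1, inv_one, one_smul]

theorem norm_alpha (s : G) (f : LInfty μ) : ‖alpha s f‖ = ‖f‖ :=
  Lp.norm_compMeasurePreserving _ _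

theorem norm_toL2_alpha [IsFiniteMeasure μ] (s : G) (f : LInfty μ) :
    ‖toL2 μ (alpha s f)‖ = ‖toL2 μ f‖ := by
  rw [← Lp.norm_compMeasurePreserving (toL2 μ f) (measurePreserving_smul s⁻¹ μ)]
  congr 1
  ext1
  filter_upwards [coeFn_alpha s f, coeFn_toL2 (alpha s f), ae_smul s⁻¹ (coeFn_toL2 f),
    Lp.coeFn_compMeasurePreserving (toL2 μ f) (measurePreserving_smul s⁻¹ μ)] with x h1 h2 h3 h4
  rw [h2, h1, h4, Function.comp_apply, h3]

end AlphaBasics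

/-! ### Density of the generated algebra -/

section Generated

variable {G X : Type*} [Group G] [MulAction G X] [MeasurableSpace X] [MeasurableConstSMul G X]
  {μ : Measure X} [SMulInvariantMeasure G X μ]

variable (G) in
/-- The unital algebra generated by the translates `α_s(p_n)` of the members of a sequence. It is
a *-algebra when the `p_n` are real-valued, see `star_mem_genAlg`. -/
def genAlg (p : ℕ → LInfty μ) : Subalgebra ℂ (LInfty μ) :=
  Algebra.adjoin ℂ (Set.range fun z : G × ℕ => alpha z.1 (p z.2))

theorem alpha_seq_mem_genAlg (p : ℕ → LInfty μ) (s : G) (n : ℕ) :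
    alpha s (p n) ∈ genAlg G p :=
  Algebra.subset_adjoin ⟨(s, n), rfl⟩

theorem seq_mem_genAlg (p : ℕ → LInfty μ) (n : ℕ) : p n ∈ genAlg G p := by
  simpa only [alpha_one] using alpha_seq_mem_genAlg p (1 : G) n

theorem alpha_mem_genAlg {p : ℕ → LInfty μ} (s : G) {f : LInfty μ} (hf : f ∈ genAlg G p) :
    alpha s f ∈ genAlg G p := by
  suffices genAlg G p ≤ (genAlg G p).comap (alphaHom s) from this hf
  refine Algebra.adjoin_le ?_
  rintro _ ⟨z, rfl⟩
  simp only [Subalgebra.coe_comap, Set.mem_preimage, SetLike.mem_coe, alphaHom_apply, alpha_alpha]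
  exact alpha_seq_mem_genAlg p _ _

theorem IsRealUnitBallSeq.star_eq {p : ℕ → LInfty μ} (hp : IsRealUnitBallSeq p) (n : ℕ) :
    star (p n) = p n := by
  ext1
  filter_upwards [coeFn_star (p n), (hp n).2] with x h1 h2
  rw [h1]
  exact Complex.conj_eq_iff_im.2 h2

theorem star_mem_genAlg {p : ℕ → LInfty μ} (hp : IsRealUnitBallSeq p) {f : LInfty μ}
    (hf : f ∈ genAlg G p) : star f ∈ genAlg G p := by
  induction hf using Algebra.adjoin_induction with
  | mem f hf =>
    obtain ⟨z, rfl⟩ := hf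
    simp only [← alpha_star, hp.star_eq]
    exact alpha_seq_mem_genAlg p _ _
  | algebraMap c =>
    rw [← algebraMap_star_comm]
    exact Subalgebra.algebraMap_mem _ _
  | add f g _ _ h1 h2 => rw [star_add]; exact add_mem h1 h2
  | mul f g _ _ h1 h2 => rw [star_mul]; exact mul_mem h2 h1

section Density

variable [IsProbabilityMeasure μ]

/-- The elements of `L^∞(X, μ)` that are `L²`-limits of elements of the generated algebra. No
bound on the norms of the approximants is required for this to be an algebra: one approximates the
second factor first, and then the first one depending on it. -/
def l2Closure {p : ℕ → LInfty μ} (hp : IsRealUnitBallSeq p) :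
    StarSubalgebra ℂ (LInfty μ) where
  carrier := {f | ∀ η : ℝ, 0 < η → ∃ g ∈ genAlg G p, ‖toL2 μ (f - g)‖ < η}
  mul_mem' := by
    intro f g hf hg η hη
    obtain ⟨b, hb, hgb⟩ := hg (η / 2 / (‖f‖ + 1)) (by positivity)
    obtain ⟨a, ha, hfa⟩ := hf (η / 2 / (‖b‖ + 1)) (by positivity)
    refine ⟨a * b, mul_mem ha hb, ?_⟩
    have h1 : f * g - a * b = f * (g - b) + b * (f - a) := by ring
    rw [h1, map_add]
    refine (norm_add_le _ _).trans_lt ?_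
    have h2 := norm_toL2_mul_le f (g - b)
    have h3 := norm_toL2_mul_le b (f - a)
    rw [lt_div_iff₀ (by positivity)] at hgb hfa
    nlinarith [norm_nonneg (toL2 μ (g - b)), norm_nonneg (toL2 μ (f - a))]
  add_mem' := by
    intro f g hf hg η hη
    obtain ⟨a, ha, hfa⟩ := hf (η / 2) (by positivity)
    obtain ⟨b, hb, hgb⟩ := hg (η / 2) (by positivity)
    refine ⟨a + b, add_mem ha hb, ?_⟩
    rw [add_sub_add_comm, map_add]
    exact (norm_add_le _ _).trans_lt (by linarith)
  algebraMap_mem' c η hη := ⟨_, Subalgebra.algebraMap_mem _ c, by simpa using hη⟩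
  star_mem' := by
    intro f hf η hη
    obtain ⟨a, ha, hfa⟩ := hf η hη
    exact ⟨star a, star_mem_genAlg hp ha, by rwa [← star_sub, norm_toL2_star]⟩

theorem mem_l2Closure_iff {p : ℕ → LInfty μ} (hp : IsRealUnitBallSeq p) (f : LInfty μ) :
    f ∈ l2Closure (G := G) hp ↔
      toL2 μ f ∈ ((Subalgebra.toSubmodule (genAlg G p)).map (toL2 μ)).topologicalClosure := by
  rw [← SetLike.mem_coe (A := Submodule ℂ (Lp ℂ 2 μ)), Submodule.topologicalClosure_coe,
    Metric.mem_closure_iff]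
  constructor
  · intro h η hη
    obtain ⟨g, hg, hfg⟩ := h η hη
    exact ⟨toL2 μ g, ⟨g, hg, rfl⟩, by rwa [dist_eq_norm, ← map_sub]⟩
  · intro h η hη
    obtain ⟨_, ⟨g, hg, rfl⟩, hfg⟩ := h η hη
    exact ⟨g, hg, by rwa [map_sub, ← dist_eq_norm]⟩

/-- The `L²`-closure is the common kernel of the functionals `f ↦ ⟨h, f⟩` with `h ∈ L²` orthogonal
to the algebra; these are weak-* continuous since `L² ⊆ L¹`. -/
theorem isVonNeumannSubalgebra_l2Closure {p : ℕ → LInfty μ} (hp : IsRealUnitBallSeq p) :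
    IsVonNeumannSubalgebra (l2Closure (G := G) hp) := by
  set K : Submodule ℂ (Lp ℂ 2 μ) := (Subalgebra.toSubmodule (genAlg G p)).map (toL2 μ) with hK
  have hL1 : ∀ h : Lp ℂ 2 μ, MemLp (fun x => star (h x)) 1 μ := fun h =>
    ((Lp.memLp h).mono_exponent (by norm_num)).star
  have key : (l2Closure (G := G) hp : Set (LInfty μ)) =
      (fun f (g : Lp ℂ 1 μ) => ∫ x, f x * g x ∂μ) ⁻¹'
        ⋂ h ∈ Kᗮ, {F : Lp ℂ 1 μ → ℂ | F (hL1 h).toLp = 0} := by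
    ext f
    rw [SetLike.mem_coe, mem_l2Closure_iff, ← hK, ← Submodule.orthogonal_orthogonal_eq_closure,
      Submodule.mem_orthogonal]
    simp only [Set.mem_preimage, Set.mem_iInter, Set.mem_ofPred_eq]
    refine forall₂_congr fun h _ => ?_
    rw [L2.inner_def]
    refine Eq.congr (integral_congr_ae ?_) rfl
    filter_upwards [(hL1 h).coeFn_toLp, coeFn_toL2 f] with x h1 h2
    rw [h1, h2, RCLike.inner_apply]
    rfl
  rw [IsVonNeumannSubalgebra, key]
  refine @IsClosed.preimage _ _ (weakStarTopology μ) _ _ continuous_induced_dom _ ?_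
  exact isClosed_biInter fun h _ => isClosed_singleton.preimage (continuous_apply _)

/-- The algebra generated by the translates of a dynamically generating sequence is `L²`-dense. -/
theorem exists_genAlg_near {p : ℕ → LInfty μ} (hp : IsRealUnitBallSeq p)
    (hgen : IsDynamicallyGenerating G (Set.range p)) (f : LInfty μ) {η : ℝ} (hη : 0 < η) :
    ∃ g ∈ genAlg G p, ‖toL2 μ (f - g)‖ < η := by
  have h : l2Closure (G := G) hp = ⊤ := by
    refine hgen _ (isVonNeumannSubalgebra_l2Closure hp) ?_ ?_
    · intro s f hf η hη
      obtain ⟨g, hg, hfg⟩ := hf η hη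
      refine ⟨alpha s g, alpha_mem_genAlg s hg, ?_⟩
      rw [← alphaHom_apply, ← alphaHom_apply, ← map_sub, alphaHom_apply, norm_toL2_alpha]
      exact hfg
    · rintro _ ⟨n, rfl⟩ η hη
      exact ⟨p n, seq_mem_genAlg p n, by simpa using hη⟩
  have hf : f ∈ l2Closure (G := G) hp := h ▸ StarSubalgebra.mem_top
  exact hf η hη

end Density

end Generated

/-! ### Approximation of indicator functions -/

section Clamp

variable {X : Type*} [MeasurableSpace X] {μ : Measure X}

theorem coeFn_aeval (w : Polynomial ℂ) (f : LInfty μ) :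
    ⇑(Polynomial.aeval f w) =ᵐ[μ] fun x => w.eval (f x) := by
  induction w using Polynomial.induction_on' with
  | add v w hv hw =>
    filter_upwards [hv, hw, Lp.coeFn_add (Polynomial.aeval f v) (Polynomial.aeval f w)]
      with x h1 h2 h3
    rw [map_add, h3, Pi.add_apply, h1, h2, Polynomial.eval_add]
  | monomial n c =>
    have hpow : ∀ n : ℕ, ⇑(f ^ n) =ᵐ[μ] fun x => f x ^ n := by
      intro n
      induction n with
      | zero => simpa using coeFn_one (μ := μ)
      | succ n ih =>
        filter_upwards [ih, coeFn_mul (f ^ n) f] with x h1 h2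
        rw [pow_succ, h2, h1, pow_succ]
    filter_upwards [hpow n, coeFn_mul (algebraMap ℂ (LInfty μ) c) (f ^ n),
      coeFn_algebraMap (μ := μ) c] with x h1 h2 h3
    rw [Polynomial.aeval_monomial, h2, h1, h3, Polynomial.eval_monomial]

/-- The class in `L^∞(X, μ)` of the indicator function of a measurable set. -/
def ind (μ : Measure X) {B : Set X} (hB : MeasurableSet B) : LInfty μ :=
  MemLp.toLp (B.indicator fun _ => (1 : ℂ)) ((memLp_top_const 1).indicator hB)

theorem coeFn_ind {B : Set X} (hB : MeasurableSet B) :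
    ⇑(ind μ hB) =ᵐ[μ] B.indicator fun _ => (1 : ℂ) :=
  MemLp.coeFn_toLp _

/-- A polynomial with values in `[0, 1]` on `[-M, M]` approximating the retraction of `ℝ` onto
`[0, 1]`. -/
theorem exists_polynomial_near_clamp (M : ℝ) {η : ℝ} (hη : 0 < η) :
    ∃ w : Polynomial ℝ, ∀ t ∈ Set.Icc (-M) M,
      0 ≤ w.eval t ∧ w.eval t ≤ 1 ∧ |w.eval t - max 0 (min 1 t)| ≤ η := by
  obtain ⟨v, hv⟩ := exists_polynomial_near_of_continuousOn (-M) M (fun t => max 0 (min 1 t))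
    (by fun_prop) (η / 2) (by positivity)
  -- shift by `η / 2` and rescale, to bring the values back into `[0, 1]`
  refine ⟨Polynomial.C (1 / (1 + η)) * (v + Polynomial.C (η / 2)), fun t ht => ?_⟩
  have h := abs_lt.1 (hv t ht)
  have h0 : 0 ≤ max 0 (min 1 t) := le_max_left _ _
  have h1 : max 0 (min 1 t) ≤ 1 := max_le zero_le_one (min_le_left _ _)
  set c := max 0 (min 1 t)
  set e := v.eval t
  have hpos : 0 < 1 + η := by positivity
  have he : Polynomial.eval t (Polynomial.C (1 / (1 + η)) * (v + Polynomial.C (η / 2))) =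
      (e + η / 2) / (1 + η) := by
    simp [e]; ring
  rw [he]
  refine ⟨div_nonneg (by linarith) hpos.le, (div_le_one hpos).2 (by linarith), ?_⟩
  rw [abs_le, sub_le_iff_le_add, div_le_iff₀ hpos, le_sub_iff_add_le, le_div_iff₀ hpos]
  constructor <;> nlinarith

end Clamp

section ClampDensity

variable {G X : Type*} [Group G] [MulAction G X] [MeasurableSpace X] [MeasurableConstSMul G X]
  {μ : Measure X} [SMulInvariantMeasure G X μ] [IsProbabilityMeasure μ]

/-- Indicator functions are `L²`-limits of elements of the generated algebra with values in
`[0, 1]`. -/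
theorem exists_genAlg_near_ind {p : ℕ → LInfty μ} (hp : IsRealUnitBallSeq p)
    (hgen : IsDynamicallyGenerating G (Set.range p)) {B : Set X} (hB : MeasurableSet B)
    {η : ℝ} (hη : 0 < η) :
    ∃ b ∈ genAlg G p, (∀ᵐ x ∂μ, 0 ≤ b x ∧ b x ≤ 1) ∧ ‖toL2 μ (b - ind μ hB)‖ < η := by
  obtain ⟨a, ha, hab⟩ := exists_genAlg_near hp hgen (ind μ hB) (half_pos hη)
  set r : LInfty μ := (1 / 2 : ℂ) • (a + star a) with hr
  have hrx : ∀ᵐ x ∂μ, r x = (((a x).re : ℝ) : ℂ) := by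
    filter_upwards [Lp.coeFn_smul (1 / 2 : ℂ) (a + star a), Lp.coeFn_add a (star a),
      coeFn_star a] with x h1 h2 h3
    rw [hr, h1, Pi.smul_apply, h2, Pi.add_apply, h3]
    apply Complex.ext <;> simp
    ring
  have hrmem : r ∈ genAlg G p :=
    Subalgebra.smul_mem _ (add_mem ha (star_mem_genAlg hp ha)) _
  obtain ⟨w, hw⟩ := exists_polynomial_near_clamp ‖a‖ (half_pos (half_pos hη))
  have hbx : ∀ᵐ x ∂μ, Polynomial.aeval r (w.map (algebraMap ℝ ℂ)) x =
      ((w.eval (a x).re : ℝ) : ℂ) ∧ (a x).re ∈ Set.Icc (-‖a‖) ‖a‖ := by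
    filter_upwards [hrx, coeFn_aeval (w.map (algebraMap ℝ ℂ)) r, ae_norm_le_norm a]
      with x h1 h2 h3
    refine ⟨?_, abs_le.1 ((Complex.abs_re_le_norm _).trans h3)⟩
    rw [h2, h1]
    exact Polynomial.eval_map_algebraMap w _ |>.trans (Polynomial.aeval_algebraMap_apply_eq_algebraMap_eval _ w)
  refine ⟨Polynomial.aeval r (w.map (algebraMap ℝ ℂ)),
    Algebra.adjoin_le (Set.singleton_subset_iff.2 hrmem)
      (Polynomial.aeval_mem_adjoin_singleton ℂ r), ?_, ?_⟩
  · filter_upwards [hbx] with x ⟨h1, h2⟩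
    rw [h1]
    exact ⟨by exact_mod_cast (hw _ h2).1, by exact_mod_cast (hw _ h2).2.1⟩
  · refine (norm_toL2_le_add (g := ind μ hB - a) (half_pos (half_pos hη)).le ?_).trans_lt
      (by linarith)
    filter_upwards [hbx, coeFn_ind (μ := μ) hB, Lp.coeFn_sub (ind μ hB) a, Lp.coeFn_sub
      (Polynomial.aeval r (w.map (algebraMap ℝ ℂ))) (ind μ hB)] with x ⟨h1, h2⟩ h3 h4 h5
    rw [h5, h4, Pi.sub_apply, Pi.sub_apply, h1, h3]
    have hc := (hw _ h2).2.2
    set χ : ℝ := B.indicator (fun _ => (1 : ℝ)) x with hχ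
    have hχ' : B.indicator (fun _ => (1 : ℂ)) x = (χ : ℂ) := by
      rw [hχ]; by_cases hx : x ∈ B <;> simp [hx]
    have hχ01 : max 0 (min 1 χ) = χ := by
      rw [hχ]; by_cases hx : x ∈ B <;> simp [hx]
    rw [hχ', ← Complex.ofReal_sub, Complex.norm_real, Real.norm_eq_abs]
    have h6 : |max 0 (min 1 (a x).re) - max 0 (min 1 χ)| ≤ |(a x).re - χ| := by
      refine (abs_max_sub_max_le_max _ _ _ _).trans ?_
      simp only [sub_self, abs_zero]
      refine max_le (abs_nonneg _) ((abs_min_sub_min_le_max _ _ _ _).trans ?_)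
      simp
    have h7 : |(a x).re - χ| ≤ ‖(χ : ℂ) - a x‖ := by
      rw [abs_sub_comm]
      simpa using Complex.abs_re_le_norm ((χ : ℂ) - a x)
    have h8 := abs_sub_le (w.eval (a x).re) (max 0 (min 1 (a x).re)) χ
    rw [hχ01] at h6
    linarith

end ClampDensity

/-! ### States given by averages -/

section Averages

variable {X : Type*} [MeasurableSpace X] {μ : Measure X}

/-- The state `f ↦ ∫ f dν` on `L^∞(X, μ)` for `ν` absolutely continuous with respect to `μ`. -/
def stateOf (ν : Measure X) [IsProbabilityMeasure ν] (h : ν ≪ μ) : LInfty μ →ₗ[ℂ] ℂ where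
  toFun f := ∫ x, f x ∂ν
  map_add' f g := by
    have hint : ∀ f : LInfty μ, Integrable f ν := fun f =>
      Integrable.of_bound ((Lp.aestronglyMeasurable f).mono_ac h) ‖f‖ (h.ae_le (ae_norm_le_norm f))
    rw [← integral_add (hint f) (hint g)]
    exact integral_congr_ae (h.ae_le (Lp.coeFn_add f g))
  map_smul' c f := by
    rw [RingHom.id_apply, ← integral_smul]
    exact integral_congr_ae (h.ae_le (Lp.coeFn_smul c f))

theorem norm_stateOf_sub_le (ν : Measure X) [IsProbabilityMeasure ν] (h : ν ≪ μ) (f : LInfty μ)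
    (c : ℂ) {η : ℝ} (hf : ∀ᵐ x ∂ν, ‖f x - c‖ ≤ η) : ‖stateOf ν h f - c‖ ≤ η := by
  have hint : Integrable f ν :=
    Integrable.of_bound ((Lp.aestronglyMeasurable f).mono_ac h) ‖f‖ (h.ae_le (ae_norm_le_norm f))
  have h1 : stateOf ν h f - c = ∫ x, (f x - c) ∂ν := by
    rw [integral_sub hint (integrable_const c)]
    simp [stateOf]
  rw [h1]
  simpa using norm_integral_le_of_norm_le_const hf

variable (μ) [IsProbabilityMeasure μ] in
/-- States of `L^∞(X, μ)` concentrated on a given set `B`: the average over `B`, which exists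
unless `B` is null. -/
theorem exists_state_concentrated {B : Set X} (hB : MeasurableSet B) :
    ∃ l : LInfty μ →ₗ[ℂ] ℂ, l 1 = 1 ∧ (∀ f : LInfty μ, (∀ᵐ x ∂μ, 0 ≤ f x) → 0 ≤ l f) ∧
      (∀ f, ‖l f‖ ≤ ‖f‖) ∧ ∀ (f : LInfty μ) (c : ℂ) (η : ℝ),
        (∀ᵐ x ∂μ, x ∈ B → ‖f x - c‖ ≤ η) → μ B = 0 ∨ ‖l f - c‖ ≤ η := by
  obtain ⟨ν, hν, hac, hmem⟩ : ∃ ν : Measure X, IsProbabilityMeasure ν ∧ ν ≪ μ ∧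
      (μ B = 0 ∨ ∀ᵐ x ∂ν, x ∈ B) := by
    by_cases h0 : μ B = 0
    · exact ⟨μ, inferInstance, Measure.AbsolutelyContinuous.rfl, Or.inl h0⟩
    · exact ⟨ProbabilityTheory.cond μ B, ProbabilityTheory.cond_isProbabilityMeasure h0,
        ProbabilityTheory.cond_absolutelyContinuous, Or.inr (ProbabilityTheory.ae_cond_mem hB)⟩
  refine ⟨stateOf ν hac, ?_, fun f hf => ?_, fun f => ?_, fun f c η hf => ?_⟩
  · have : ∫ x, (1 : LInfty μ) x ∂ν = ∫ _, (1 : ℂ) ∂ν :=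
      integral_congr_ae (hac.ae_le coeFn_one)
    simpa [stateOf] using this
  · exact integral_nonneg_of_ae (hac.ae_le hf)
  · have h := hac.ae_le (ae_norm_le_norm f)
    simpa using norm_stateOf_sub_le ν hac f 0 (by filter_upwards [h] with x hx; simpa using hx)
  · refine hmem.imp id fun hm => norm_stateOf_sub_le ν hac f c ?_
    filter_upwards [hac.ae_le hf, hm] with x h1 h2 using h1 h2

end Averages

/-! ### Partitions of unity and of the space -/

section Disjointify

/-- The partition of unity obtained from functions `b_0, …, b_N` with `b_N = 1`: the elements
`b_i ∏_{j < i} (1 - b_j)` for `i ≤ N`. -/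
def disjointify {A : Type*} [CommRing A] (b : ℕ → A) (i : ℕ) : A :=
  (∏ j ∈ Finset.range i, (1 - b j)) * b i

theorem sum_disjointify_add {A : Type*} [CommRing A] (b : ℕ → A) (N : ℕ) :
    ∑ i ∈ Finset.range N, disjointify b i + ∏ j ∈ Finset.range N, (1 - b j) = 1 := by
  induction N with
  | zero => simp
  | succ N ih =>
    rw [Finset.sum_range_succ, Finset.prod_range_succ, disjointify]
    linear_combination ih

theorem sum_disjointify {A : Type*} [CommRing A] (b : ℕ → A) {N : ℕ} (hN : b N = 1) :
    ∑ i ∈ Finset.range (N + 1), disjointify b i = 1 := by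
  have h := sum_disjointify_add b (N + 1)
  rwa [Finset.prod_range_succ, hN, sub_self, mul_zero, add_zero] at h

theorem norm_eq_re_of_nonneg {z : ℂ} (hz : 0 ≤ z) : ‖z‖ = z.re := by
  rw [← Complex.abs_re_eq_norm.2 (Complex.nonneg_iff.1 hz).2.symm,
    abs_of_nonneg (Complex.nonneg_iff.1 hz).1]

theorem norm_sum_mul_le {ι : Type*} (s : Finset ι) (z g : ι → ℂ) (hg : ∀ i ∈ s, 0 ≤ g i)
    (hsum : ∑ i ∈ s, g i = 1) {C : ℝ} (hz : ∀ i ∈ s, g i = 0 ∨ ‖z i‖ ≤ C) :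
    ‖∑ i ∈ s, z i * g i‖ ≤ C := by
  have h1 : ∀ i ∈ s, ‖z i * g i‖ ≤ C * (g i).re := by
    intro i hi
    rw [norm_mul, norm_eq_re_of_nonneg (hg i hi)]
    rcases hz i hi with h | h
    · simp [h]
    · exact mul_le_mul_of_nonneg_right h (Complex.nonneg_iff.1 (hg i hi)).1
  refine (norm_sum_le_of_le s h1).trans ?_
  rw [← Finset.mul_sum, ← Complex.re_sum, hsum, Complex.one_re, mul_one]

variable {X : Type*} [MeasurableSpace X] {μ : Measure X}

theorem ae_disjointify (b : ℕ → LInfty μ) :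
    ∀ᵐ x ∂μ, ∀ i, disjointify b i x = disjointify (fun j => b j x) i := by
  have hprod : ∀ᵐ x ∂μ, ∀ i, (∏ j ∈ Finset.range i, (1 - b j) : LInfty μ) x =
      ∏ j ∈ Finset.range i, (1 - b j x) := by
    rw [ae_all_iff]
    intro i
    induction i with
    | zero => filter_upwards [coeFn_one (μ := μ)] with x hx using by simpa using hx
    | succ i ih =>
      filter_upwards [ih, coeFn_mul (∏ j ∈ Finset.range i, (1 - b j)) (1 - b i),
        Lp.coeFn_sub 1 (b i), coeFn_one (μ := μ)] with x h1 h2 h3 h4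
      rw [Finset.prod_range_succ, Finset.prod_range_succ, h2, h1, h3, Pi.sub_apply, h4]
  have hmul : ∀ᵐ x ∂μ, ∀ i, disjointify b i x =
      (∏ j ∈ Finset.range i, (1 - b j) : LInfty μ) x * b i x :=
    ae_all_iff.2 fun i => coeFn_mul _ _
  filter_upwards [hprod, hmul] with x h1 h2 i
  rw [h2, h1, disjointify]

theorem disjointify_nonneg {b : ℕ → ℂ} (hb : ∀ i, 0 ≤ b i ∧ b i ≤ 1) (i : ℕ) :
    0 ≤ disjointify b i :=
  mul_nonneg (Finset.prod_nonneg fun j _ => sub_nonneg.2 (hb j).2) (hb i).1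

theorem ae_coeFn_sum {ι : Type*} (s : Finset ι) (f : ι → LInfty μ) :
    ∀ᵐ x ∂μ, (∑ i ∈ s, f i : LInfty μ) x = ∑ i ∈ s, f i x := by
  classical
  induction s using Finset.induction_on with
  | empty => filter_upwards [Lp.coeFn_zero ℂ ∞ μ] with x hx using by simpa using hx
  | insert i s hi ih =>
    filter_upwards [ih, Lp.coeFn_add (f i) (∑ i ∈ s, f i)] with x h1 h2
    rw [Finset.sum_insert hi, Finset.sum_insert hi, h2, Pi.add_apply, h1]

theorem norm_one_sub_le_one {b : LInfty μ} (hb : ∀ᵐ x ∂μ, 0 ≤ b x ∧ b x ≤ 1) : ‖1 - b‖ ≤ 1 := by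
  refine norm_le_of_ae_norm_le zero_le_one ?_
  filter_upwards [hb, Lp.coeFn_sub 1 b, coeFn_one (μ := μ)] with x h1 h2 h3
  rw [h2, Pi.sub_apply, h3, norm_eq_re_of_nonneg (sub_nonneg.2 h1.2), Complex.sub_re,
    Complex.one_re, sub_le_self_iff]
  exact (Complex.nonneg_iff.1 h1.1).1

theorem norm_le_one_of_unit {b : LInfty μ} (hb : ∀ᵐ x ∂μ, 0 ≤ b x ∧ b x ≤ 1) : ‖b‖ ≤ 1 := by
  refine norm_le_of_ae_norm_le zero_le_one ?_
  filter_upwards [hb] with x h1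
  rw [norm_eq_re_of_nonneg h1.1]
  exact (Complex.le_def.1 h1.2).1

theorem norm_toL2_mul_sub_mul_le [IsFiniteMeasure μ] {u U v V : LInfty μ} (hu : ‖u‖ ≤ 1)
    (hV : ‖V‖ ≤ 1) :
    ‖toL2 μ (u * v - U * V)‖ ≤ ‖toL2 μ (u - U)‖ + ‖toL2 μ (v - V)‖ := by
  have h1 : u * v - U * V = V * (u - U) + u * (v - V) := by ring
  rw [h1, map_add]
  refine (norm_add_le _ _).trans (add_le_add ?_ ?_)
  · exact (norm_toL2_mul_le _ _).trans (mul_le_of_le_one_left (norm_nonneg _) hV)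
  · exact (norm_toL2_mul_le _ _).trans (mul_le_of_le_one_left (norm_nonneg _) hu)

theorem norm_toL2_prod_sub_prod_le [IsFiniteMeasure μ] {ι : Type*} (s : Finset ι)
    {f g : ι → LInfty μ} (hf : ∀ i ∈ s, ‖f i‖ ≤ 1) (hg : ∀ i ∈ s, ‖g i‖ ≤ 1) :
    ‖toL2 μ (∏ i ∈ s, f i - ∏ i ∈ s, g i)‖ ≤ ∑ i ∈ s, ‖toL2 μ (f i - g i)‖ := by
  classical
  induction s using Finset.induction_on with
  | empty => simp
  | insert i s hi ih =>
    rw [Finset.prod_insert hi, Finset.prod_insert hi, Finset.sum_insert hi]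
    refine (norm_toL2_mul_sub_mul_le (hf i (Finset.mem_insert_self i s))
      (norm_prod_le_one s g fun j hj => hg j (Finset.mem_insert_of_mem hj))).trans ?_
    gcongr
    exact ih (fun j hj => hf j (Finset.mem_insert_of_mem hj))
      fun j hj => hg j (Finset.mem_insert_of_mem hj)

/-- The partition of unity depends continuously on the functions it is made of, in `L²`. -/
theorem norm_toL2_disjointify_sub_le [IsProbabilityMeasure μ] {b c : ℕ → LInfty μ}
    (hb : ∀ i, ∀ᵐ x ∂μ, 0 ≤ b i x ∧ b i x ≤ 1) (hc : ∀ i, ∀ᵐ x ∂μ, 0 ≤ c i x ∧ c i x ≤ 1)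
    {η : ℝ} (h : ∀ i, ‖toL2 μ (b i - c i)‖ ≤ η) (i : ℕ) :
    ‖toL2 μ (disjointify b i - disjointify c i)‖ ≤ (i + 1) * η := by
  have hu : ∀ i, ‖∏ j ∈ Finset.range i, (1 - b j)‖ ≤ 1 := fun i =>
    norm_prod_le_one _ _ fun j _ => norm_one_sub_le_one (hb j)
  have hprod : ∀ i : ℕ, ‖toL2 μ (∏ j ∈ Finset.range i, (1 - b j) -
      ∏ j ∈ Finset.range i, (1 - c j))‖ ≤ i * η := by
    intro i
    induction i with
    | zero => simp
    | succ i ih =>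
      rw [Finset.prod_range_succ, Finset.prod_range_succ]
      refine (norm_toL2_mul_sub_mul_le (hu i) (norm_one_sub_le_one (hc i))).trans ?_
      have h2 : (1 - b i) - (1 - c i) = -(b i - c i) := by ring
      rw [h2, map_neg, norm_neg]
      push_cast
      linarith [h i]
  refine (norm_toL2_mul_sub_mul_le (hu i) (norm_le_one_of_unit (hc i))).trans ?_
  linarith [hprod i, h i]

/-- Finitely many balls of `ℂ^Φ` of small radius cover the essential range of `(f)_{f ∈ Φ}`. -/
theorem exists_cover_small_oscillation {Φ : Set (LInfty μ)} (hΦ : Φ.Finite) {η : ℝ} (hη : 0 < η) :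
    ∃ (N : ℕ) (B : ℕ → Set X) (c : ℕ → LInfty μ → ℂ), (∀ i, MeasurableSet (B i)) ∧
      (∀ᵐ x ∂μ, ∃ i < N, x ∈ B i) ∧ ∀ i, ∀ f ∈ Φ, ∀ x ∈ B i, ‖f x - c i f‖ ≤ η := by
  classical
  have := hΦ.fintype
  let F : X → Φ → ℂ := fun x f => f.1 x
  have hF : Measurable F :=
    measurable_pi_lambda _ fun f => (Lp.stronglyMeasurable f.1).measurable
  let D := TopologicalSpace.denseSeq (Φ → ℂ)
  have hK : IsCompact (Set.univ.pi fun f : Φ => Metric.closedBall (0 : ℂ) ‖f.1‖) :=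
    isCompact_univ_pi fun f => isCompact_closedBall _ _
  obtain ⟨t, ht⟩ := hK.elim_finite_subcover (fun i => Metric.ball (D i) η)
    (fun i => Metric.isOpen_ball) fun y _ => by
      obtain ⟨i, hi⟩ := (TopologicalSpace.denseRange_denseSeq (Φ → ℂ)).exists_dist_lt y hη
      exact Set.mem_iUnion.2 ⟨i, hi⟩
  refine ⟨t.sup id + 1, fun i => F ⁻¹' Metric.ball (D i) η,
    fun i f => if hf : f ∈ Φ then D i ⟨f, hf⟩ else 0, fun i => hF measurableSet_ball, ?_, ?_⟩
  · have : ∀ᵐ x ∂μ, ∀ f : Φ, ‖f.1 x‖ ≤ ‖f.1‖ := ae_all_iff.2 fun f => ae_norm_le_norm f.1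
    filter_upwards [this] with x hx
    obtain ⟨i, hi, hxi⟩ := Set.mem_iUnion₂.1
      (ht (show F x ∈ _ from fun f _ => mem_closedBall_zero_iff.2 (hx f)))
    exact ⟨i, Nat.lt_succ_of_le (Finset.le_sup (f := id) hi), hxi⟩
  · intro i f hf x hx
    simp only [dif_pos hf]
    rw [← dist_eq_norm]
    exact (dist_le_pi_dist (F x) (D i) ⟨f, hf⟩).trans (Metric.mem_ball.1 hx).le

end Disjointify

/-! ### Positive maps into the generated algebra -/

section Smoothing

variable {G X : Type*} [Group G] [MulAction G X] [MeasurableSpace X] [MeasurableConstSMul G X]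
  {μ : Measure X} [SMulInvariantMeasure G X μ]

variable (G) in
/-- A unital positive linear contraction of `L^∞(X, μ)` into the algebra generated by the
translates of a sequence. The composition `φ ∘ θ` of a positive map `φ` with a smoothing `θ` only
depends on the restriction of `φ` to this algebra. -/
structure IsSmoothing (p : ℕ → LInfty μ) (θ : LInfty μ →ₗ[ℂ] LInfty μ) : Prop where
  map_one : θ 1 = 1
  nonneg : ∀ f : LInfty μ, (∀ᵐ x ∂μ, 0 ≤ f x) → ∀ᵐ x ∂μ, 0 ≤ θ f x
  norm_le : ∀ f : LInfty μ, ‖θ f‖ ≤ ‖f‖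
  mem : ∀ f : LInfty μ, θ f ∈ genAlg G p

variable [IsProbabilityMeasure μ]

/-- For a dynamically generating sequence there are smoothings arbitrarily `L²`-close to the
identity on a given finite set. They are of the form `f ↦ ∑ λ_i(f) g_i`, where `λ_i` is the average
over a set on which the functions in question are almost constant, and `g_i` is a partition of
unity in the algebra approximating the corresponding measurable partition. -/
theorem exists_isSmoothing_near {p : ℕ → LInfty μ} (hp : IsRealUnitBallSeq p)
    (hgen : IsDynamicallyGenerating G (Set.range p)) {Φ : Set (LInfty μ)} (hΦ : Φ.Finite)
    {η : ℝ} (hη : 0 < η) :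
    ∃ θ : LInfty μ →ₗ[ℂ] LInfty μ, IsSmoothing G p θ ∧ ∀ f ∈ Φ, ‖toL2 μ (θ f - f)‖ < η := by
  obtain ⟨N, B, c, hB, hcov, hosc⟩ := exists_cover_small_oscillation hΦ (η := η / 8) (by positivity)
  obtain ⟨C, hC⟩ : ∃ C : ℝ, ∀ f ∈ Φ, ‖f‖ ≤ C := by
    obtain ⟨C, hC⟩ := (hΦ.image fun f => ‖f‖).bddAbove
    exact ⟨C, fun f hf => hC ⟨f, hf, rfl⟩⟩
  -- the index `N` is reserved for the whole space, so that the functions `g_i` sum up to `1`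
  set B' : ℕ → Set X := fun i => if i < N then B i else Set.univ with hB'
  have hB'm : ∀ i, MeasurableSet (B' i) := by
    intro i
    by_cases hi : i < N
    · simpa [hB', hi] using hB i
    · simp [hB', hi]
  set η' : ℝ := η / (8 * (N + 1) ^ 2 * (|C| + 1)) with hη'
  have hη'0 : 0 < η' := by positivity
  set χ : ℕ → LInfty μ := fun i => ind μ (hB'm i) with hχdef
  have hχ : ∀ i, ∀ᵐ x ∂μ, 0 ≤ χ i x ∧ χ i x ≤ 1 := by
    intro i
    filter_upwards [coeFn_ind (μ := μ) (hB'm i)] with x hx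
    rw [hχdef]
    simp only
    rw [hx]
    by_cases h : x ∈ B' i <;> simp [h]
  have hχN : χ N = 1 := by
    ext1
    filter_upwards [coeFn_ind (μ := μ) (hB'm N), coeFn_one (μ := μ)] with x h1 h2
    rw [hχdef]
    simp only
    rw [h1, h2]
    simp [hB']
  have hbex : ∀ i, ∃ b ∈ genAlg G p, (∀ᵐ x ∂μ, 0 ≤ b x ∧ b x ≤ 1) ∧ ‖toL2 μ (b - χ i)‖ ≤ η' ∧
      (i = N → b = 1) := by
    intro i
    by_cases hi : i = N
    · subst hi
      refine ⟨1, one_mem _, ?_, ?_, fun _ => rfl⟩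
      · filter_upwards [coeFn_one (μ := μ)] with x hx
        rw [hx]
        simp
      · simpa [hχN] using hη'0.le
    · obtain ⟨b, h1, h2, h3⟩ := exists_genAlg_near_ind hp hgen (hB'm i) hη'0
      exact ⟨b, h1, h2, h3.le, fun h => absurd h hi⟩
  choose b hbmem hb hbχ hbN using hbex
  choose l hl1 hlpos hlnorm hlconc using fun i => exists_state_concentrated μ (hB'm i)
  set θ : LInfty μ →ₗ[ℂ] LInfty μ :=
    ∑ i ∈ Finset.range (N + 1), (l i).smulRight (disjointify b i) with hθ
  have hθapp : ∀ f, θ f = ∑ i ∈ Finset.range (N + 1), l i f • disjointify b i := by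
    intro f
    simp [hθ]
  have hθx : ∀ f, ∀ᵐ x ∂μ, θ f x =
      ∑ i ∈ Finset.range (N + 1), l i f * disjointify (fun j => b j x) i := by
    intro f
    have h3 : ∀ᵐ x ∂μ, ∀ i, (l i f • disjointify b i : LInfty μ) x = l i f * disjointify b i x :=
      ae_all_iff.2 fun i => Lp.coeFn_smul _ _
    rw [hθapp]
    filter_upwards [ae_coeFn_sum (Finset.range (N + 1)) fun i => l i f • disjointify b i,
      ae_disjointify b, h3] with x h1 h2 h3
    rw [h1]
    exact Finset.sum_congr rfl fun i _ => by rw [h3, h2]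
  have hbx : ∀ᵐ x ∂μ, (∀ i, 0 ≤ b i x ∧ b i x ≤ 1) ∧ b N x = 1 := by
    have : ∀ᵐ x ∂μ, ∀ i, 0 ≤ b i x ∧ b i x ≤ 1 := ae_all_iff.2 hb
    filter_upwards [this, coeFn_one (μ := μ)] with x h1 h2
    exact ⟨h1, by rw [hbN N rfl, h2]⟩
  refine ⟨θ, ⟨?_, ?_, ?_, ?_⟩, ?_⟩
  · simp only [hθapp, hl1, one_smul]
    exact sum_disjointify b (hbN N rfl)
  · intro f hf
    filter_upwards [hθx f, hbx] with x h1 h2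
    rw [h1]
    exact Finset.sum_nonneg fun i _ => mul_nonneg (hlpos i f hf) (disjointify_nonneg h2.1 i)
  · intro f
    refine norm_le_of_ae_norm_le (norm_nonneg _) ?_
    filter_upwards [hθx f, hbx] with x h1 h2
    rw [h1]
    exact norm_sum_mul_le _ _ _ (fun i _ => disjointify_nonneg h2.1 i)
      (sum_disjointify _ h2.2) fun i _ => Or.inr (hlnorm i f)
  · intro f
    rw [hθapp]
    exact sum_mem fun i _ => Subalgebra.smul_mem _
      (mul_mem (prod_mem fun j _ => sub_mem (one_mem _) (hbmem j)) (hbmem i)) _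
  · intro f hf
    -- compare the functions `g_i` with the indicator functions of the measurable partition
    set r : ℕ → LInfty μ := fun i => algebraMap ℂ (LInfty μ) (l i f) - f with hr
    have hr_norm : ∀ i, ‖r i‖ ≤ 2 * (|C| + 1) := by
      intro i
      have h1 : ‖algebraMap ℂ (LInfty μ) (l i f)‖ ≤ ‖f‖ := by
        refine norm_le_of_ae_norm_le (norm_nonneg _) ?_
        filter_upwards [coeFn_algebraMap (μ := μ) (l i f)] with x hx
        rw [hx]
        exact hlnorm i f
      have h2 : ‖r i‖ ≤ ‖algebraMap ℂ (LInfty μ) (l i f)‖ + ‖f‖ := norm_sub_le _ _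
      linarith [hC f hf, le_abs_self C]
    have hdec : θ f - f = ∑ i ∈ Finset.range (N + 1), r i * disjointify χ i +
        ∑ i ∈ Finset.range (N + 1), r i * (disjointify b i - disjointify χ i) := by
      have h1 : f = ∑ i ∈ Finset.range (N + 1), f * disjointify b i := by
        rw [← Finset.mul_sum, sum_disjointify b (hbN N rfl), mul_one]
      rw [hθapp, ← Finset.sum_add_distrib]
      nth_rewrite 2 [h1]
      rw [← Finset.sum_sub_distrib]
      refine Finset.sum_congr rfl fun i _ => ?_
      rw [Algebra.smul_def, hr]
      ring
    rw [hdec, map_add]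
    refine (norm_add_le _ _).trans_lt ?_
    have hfirst : ‖toL2 μ (∑ i ∈ Finset.range (N + 1), r i * disjointify χ i)‖ ≤ η / 4 := by
      refine norm_toL2_le_of_ae_norm_le (by positivity) ?_
      have h3 : ∀ᵐ x ∂μ, ∀ i, (r i * disjointify χ i) x = (l i f - f x) * disjointify χ i x := by
        refine ae_all_iff.2 fun i => ?_
        filter_upwards [coeFn_mul (r i) (disjointify χ i), coeFn_algebraMap (μ := μ) (l i f),
          Lp.coeFn_sub (algebraMap ℂ (LInfty μ) (l i f)) f] with x h1 h2 h3
        rw [h1, hr, h3, Pi.sub_apply, h2]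
      have h4 : ∀ᵐ x ∂μ, ∀ i, (0 ≤ χ i x ∧ χ i x ≤ 1) ∧
          χ i x = (B' i).indicator (fun _ => (1 : ℂ)) x := by
        refine ae_all_iff.2 fun i => ?_
        filter_upwards [hχ i, coeFn_ind (μ := μ) (hB'm i)] with x h1 h2
        exact ⟨h1, h2⟩
      have h5 : ∀ᵐ x ∂μ, ∀ i, μ (B' i) = 0 → x ∉ B' i := by
        refine ae_all_iff.2 fun i => ?_
        by_cases h0 : μ (B' i) = 0
        · filter_upwards [measure_eq_zero_iff_ae_notMem.1 h0] with x hx _ using hx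
        · exact Eventually.of_forall fun x h => absurd h h0
      filter_upwards [ae_coeFn_sum (Finset.range (N + 1)) fun i => r i * disjointify χ i,
        ae_disjointify χ, h3, h4, h5, hcov] with x h1 h2 h3 h4 h5 h6
      rw [h1, Finset.sum_congr rfl fun i _ => (h3 i).trans (by rw [h2])]
      refine norm_sum_mul_le _ _ _ (fun i _ => disjointify_nonneg (fun i => (h4 i).1) i)
        (sum_disjointify _ (by rw [(h4 N).2]; simp [hB'])) fun i hi => ?_
      by_cases hxi : x ∈ B' i
      · rcases Nat.lt_succ_iff_lt_or_eq.1 (Finset.mem_range.1 hi) with hiN | rfl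
        · refine Or.inr ?_
          have hxB : x ∈ B i := by simpa [hB', hiN] using hxi
          have h7 := (hlconc i f (c i f) (η / 8) (Eventually.of_forall fun y hy =>
            hosc i f hf y (by simpa [hB', hiN] using hy))).resolve_left fun h0 => h5 i h0 hxi
          have h8 := hosc i f hf x hxB
          rw [norm_sub_rev] at h8
          have h9 : l i f - f x = (l i f - c i f) + (c i f - f x) := by ring
          rw [h9]
          exact (norm_add_le _ _).trans (by linarith)
        · -- the sets `B_j` with `j < N` cover the space, so the last function vanishes
          obtain ⟨j, hj, hxj⟩ := h6
          refine Or.inl ?_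
          rw [disjointify, Finset.prod_eq_zero (Finset.mem_range.2 hj), zero_mul]
          rw [(h4 j).2, Set.indicator_of_mem (by simpa [hB', hj] using hxj), sub_self]
      · refine Or.inl ?_
        rw [disjointify, (h4 i).2, Set.indicator_of_notMem hxi, mul_zero]
    have hsecond : ‖toL2 μ (∑ i ∈ Finset.range (N + 1),
        r i * (disjointify b i - disjointify χ i))‖ ≤ η / 4 := by
      rw [map_sum]
      have h1 : ∀ i ∈ Finset.range (N + 1), ‖toL2 μ (r i * (disjointify b i - disjointify χ i))‖ ≤
          2 * (|C| + 1) * ((N + 1) * η') := by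
        intro i hi
        refine (norm_toL2_mul_le _ _).trans ?_
        gcongr
        · exact hr_norm i
        · refine (norm_toL2_disjointify_sub_le hb hχ hbχ i).trans ?_
          gcongr
          exact Nat.lt_succ_iff.1 (Finset.mem_range.1 hi)
      refine (norm_sum_le_of_le _ h1).trans (le_of_eq ?_)
      rw [Finset.sum_const, Finset.card_range, nsmul_eq_mul, hη']
      push_cast
      field_simp
      norm_num
    linarith

end Smoothing

/-! ### The normalized norm and the state on `ℂ^d` -/

section Norm2

variable {d : ℕ}

theorem norm2_eq (v : Fin d → ℂ) : norm2 v = Real.sqrt (1 / (d : ℝ)) * ‖WithLp.toLp 2 v‖ := by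
  rw [norm2, EuclideanSpace.norm_eq, Real.sqrt_mul (by positivity)]

theorem norm2_nonneg (v : Fin d → ℂ) : 0 ≤ norm2 v := Real.sqrt_nonneg _

theorem norm2_sq (v : Fin d → ℂ) : norm2 v ^ 2 = (1 / (d : ℝ)) * ∑ k, ‖v k‖ ^ 2 :=
  Real.sq_sqrt (by positivity)

theorem norm2_zero : norm2 (0 : Fin d → ℂ) = 0 := by simp [norm2]

theorem norm2_add_le (v w : Fin d → ℂ) : norm2 (v + w) ≤ norm2 v + norm2 w := by
  rw [norm2_eq, norm2_eq, norm2_eq, ← mul_add, WithLp.toLp_add]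
  exact mul_le_mul_of_nonneg_left (norm_add_le _ _) (Real.sqrt_nonneg _)

theorem norm2_neg (v : Fin d → ℂ) : norm2 (-v) = norm2 v := by simp [norm2]

theorem norm2_mono {v w : Fin d → ℂ} (h : ∀ k, ‖v k‖ ≤ ‖w k‖) : norm2 v ≤ norm2 w := by
  refine Real.sqrt_le_sqrt ?_
  gcongr
  exact h _

theorem norm2_smul (c : ℂ) (v : Fin d → ℂ) : norm2 (c • v) = ‖c‖ * norm2 v := by
  rw [norm2_eq, norm2_eq, WithLp.toLp_smul, norm_smul]
  ring

theorem norm2_mul_le {v w : Fin d → ℂ} {C : ℝ} (hC : 0 ≤ C) (hv : ∀ k, ‖v k‖ ≤ C) :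
    norm2 (v * w) ≤ C * norm2 w := by
  have h : norm2 (v * w) ≤ norm2 ((C : ℂ) • w) := by
    refine norm2_mono fun k => ?_
    rw [Pi.mul_apply, Pi.smul_apply, smul_eq_mul, norm_mul, norm_mul, Complex.norm_real,
      Real.norm_of_nonneg hC]
    exact mul_le_mul_of_nonneg_right (hv k) (norm_nonneg _)
  rwa [norm2_smul, Complex.norm_real, Real.norm_of_nonneg hC] at h

theorem norm2_le_of_bound {v : Fin d → ℂ} {C : ℝ} (hC : 0 ≤ C) (hv : ∀ k, ‖v k‖ ≤ C) :
    norm2 v ≤ C := by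
  have h := norm2_mul_le (w := 1) hC hv
  rw [mul_one] at h
  refine h.trans (mul_le_of_le_one_right hC ?_)
  rw [norm2, Real.sqrt_le_one]
  rcases Nat.eq_zero_or_pos d with rfl | hd
  · simp
  · simp [hd.ne']

/-- The action `v ↦ v ∘ τ⁻¹` of a permutation on `ℂ^d`. -/
def permAct (τ : Equiv.Perm (Fin d)) (v : Fin d → ℂ) : Fin d → ℂ := fun k => v (τ⁻¹ k)

theorem norm2_permAct (τ : Equiv.Perm (Fin d)) (v : Fin d → ℂ) :
    norm2 (permAct τ v) = norm2 v := by
  unfold norm2 permAct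
  rw [Equiv.sum_comp τ⁻¹ fun k => ‖v k‖ ^ 2]

theorem permAct_sub (τ : Equiv.Perm (Fin d)) (v w : Fin d → ℂ) :
    permAct τ (v - w) = permAct τ v - permAct τ w := rfl

theorem permAct_mul_apply (τ τ' : Equiv.Perm (Fin d)) (v : Fin d → ℂ) :
    permAct (τ * τ') v = permAct τ (permAct τ' v) := by
  funext k
  simp [permAct]

/-- Permutations that agree at most points act almost equally on bounded vectors. -/
theorem norm2_permAct_sub_sq_le (hd : 0 < d) (τ τ' : Equiv.Perm (Fin d)) {v : Fin d → ℂ} {C : ℝ}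
    (hv : ∀ k, ‖v k‖ ≤ C) :
    norm2 (permAct τ v - permAct τ' v) ^ 2 ≤ (2 * C) ^ 2 *
      (1 - (1 / (d : ℝ)) * (Finset.univ.filter fun k => τ k = τ' k).card) := by
  have hinv : ∀ (τ : Equiv.Perm (Fin d)) (j : Fin d), τ⁻¹ (τ j) = j := fun τ j =>
    τ.symm_apply_apply j
  have hsum : ∑ k, ‖(permAct τ v - permAct τ' v) k‖ ^ 2 ≤
      ∑ j, if τ j = τ' j then 0 else (2 * C) ^ 2 := by
    rw [← Equiv.sum_comp τ]
    refine Finset.sum_le_sum fun j _ => ?_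
    simp only [Pi.sub_apply, permAct, hinv]
    split_ifs with h
    · rw [h, hinv, sub_self]
      simp
    · gcongr
      exact (norm_sub_le _ _).trans (by linarith [hv j, hv (τ'⁻¹ (τ j))])
  have hcard : ∑ j, (if τ j = τ' j then (0 : ℝ) else (2 * C) ^ 2) =
      (2 * C) ^ 2 * (d - (Finset.univ.filter fun k => τ k = τ' k).card) := by
    have h1 : ∀ j, (if τ j = τ' j then (0 : ℝ) else (2 * C) ^ 2) =
        (2 * C) ^ 2 - (2 * C) ^ 2 * if τ j = τ' j then 1 else 0 := by
      intro j
      split_ifs <;> ring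
    rw [Finset.sum_congr rfl fun j _ => h1 j, Finset.sum_sub_distrib, ← Finset.mul_sum,
      Finset.sum_boole]
    simp
    ring
  rw [norm2_sq]
  have hd' : (0 : ℝ) < d := by exact_mod_cast hd
  calc _ ≤ (1 / (d : ℝ)) * ((2 * C) ^ 2 *
        (d - (Finset.univ.filter fun k => τ k = τ' k).card)) := by
        rw [← hcard]
        gcongr
    _ = _ := by field_simp

theorem zeta_add (v w : Fin d → ℂ) : zeta (v + w) = zeta v + zeta w := by
  simp [zeta, Finset.sum_add_distrib, mul_add]

theorem zeta_smul (c : ℂ) (v : Fin d → ℂ) : zeta (c • v) = c * zeta v := by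
  simp only [zeta, Pi.smul_apply, smul_eq_mul, ← Finset.mul_sum]
  ring

theorem zeta_one (hd : 0 < d) : zeta (1 : Fin d → ℂ) = 1 := by
  simp [zeta, hd.ne']

end Norm2

/-! ### Unital positive maps -/

section UnitalPositive

variable {X : Type*} [MeasurableSpace X] {μ : Measure X} {d : ℕ}
  {φ : LInfty μ →ₗ[ℂ] (Fin d → ℂ)}

theorem IsUnitalPositive.im_eq_zero (hφ : IsUnitalPositive φ) {f : LInfty μ} (hf : star f = f)
    (k : Fin d) : (φ f k).im = 0 := by
  have h1 : ∀ᵐ x ∂μ, 0 ≤ (((‖f‖ : ℝ) : ℂ) • (1 : LInfty μ) + f) x := by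
    filter_upwards [Lp.coeFn_add (((‖f‖ : ℝ) : ℂ) • (1 : LInfty μ)) f,
      Lp.coeFn_smul ((‖f‖ : ℝ) : ℂ) (1 : LInfty μ), coeFn_one (μ := μ), coeFn_star f,
      ae_norm_le_norm f] with x h1 h2 h3 h4 h5
    rw [hf] at h4
    rw [h1, Pi.add_apply, h2, Pi.smul_apply, h3, smul_eq_mul, mul_one, Complex.nonneg_iff]
    have him : (f x).im = 0 := Complex.conj_eq_iff_im.1 h4.symm
    have hre := (abs_le.1 ((Complex.abs_re_le_norm (f x)).trans h5)).1
    simp only [Complex.add_re, Complex.ofReal_re, Complex.add_im, Complex.ofReal_im, him]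
    exact ⟨by linarith, by simp⟩
  have h2 := hφ.nonneg _ h1 k
  rw [map_add, map_smul, hφ.map_one] at h2
  simpa using (Complex.nonneg_iff.1 h2).2.symm

theorem IsUnitalPositive.map_star (hφ : IsUnitalPositive φ) (f : LInfty μ) (k : Fin d) :
    φ (star f) k = star (φ f k) := by
  have h1 := hφ.im_eq_zero (f := f + star f) (by rw [star_add, star_star, add_comm]) k
  have h2 := hφ.im_eq_zero (f := Complex.I • (f - star f)) (by
    rw [star_smul, star_sub, star_star, Complex.star_def, Complex.conj_I, neg_smul, ← smul_neg,
      neg_sub]) k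
  simp only [map_add, map_smul, map_sub, Pi.add_apply, Pi.smul_apply, Pi.sub_apply, smul_eq_mul,
    Complex.add_im, Complex.mul_im, Complex.I_re, Complex.I_im, Complex.sub_re, zero_mul,
    one_mul, zero_add] at h1 h2
  apply Complex.ext
  · simp only [Complex.star_def, Complex.conj_re]
    linarith
  · simp only [Complex.star_def, Complex.conj_im]
    linarith

theorem ae_star_mul_self_nonneg (f : LInfty μ) : ∀ᵐ x ∂μ, 0 ≤ (star f * f) x := by
  filter_upwards [coeFn_mul (star f) f, coeFn_star f] with x h1 h2
  rw [h1, h2]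
  exact star_mul_self_nonneg _

/-- The Kadison–Schwarz inequality. -/
theorem IsUnitalPositive.norm_sq_le (hφ : IsUnitalPositive φ) (f : LInfty μ) (k : Fin d) :
    ‖φ f k‖ ^ 2 ≤ (φ (star f * f) k).re := by
  set c := φ f k with hc
  have h1 := hφ.nonneg _ (ae_star_mul_self_nonneg (f - c • 1)) k
  have h2 : star (f - c • 1) * (f - c • 1) =
      star f * f - c • star f - star c • f + (star c * c) • (1 : LInfty μ) := by
    rw [star_sub, star_smul, star_one, sub_mul, mul_sub, mul_sub, mul_smul_comm, mul_one,
      smul_mul_assoc, one_mul, smul_mul_smul_comm, one_mul]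
    abel
  rw [h2] at h1
  simp only [map_add, map_smul, map_sub, Pi.add_apply, Pi.smul_apply, Pi.sub_apply, smul_eq_mul,
    Pi.zero_apply, hφ.map_one, hφ.map_star, ← hc, Pi.one_apply, mul_one] at h1
  have h3 := (Complex.nonneg_iff.1 h1).1
  have h4 : star c * c = ((‖c‖ ^ 2 : ℝ) : ℂ) := by
    rw [Complex.star_def, Complex.conj_mul']
    norm_cast
  rw [mul_comm c, h4] at h3
  simp only [Complex.add_re, Complex.sub_re, Complex.ofReal_re] at h3
  linarith

theorem IsUnitalPositive.norm_apply_le (hφ : IsUnitalPositive φ) (f : LInfty μ) (k : Fin d) :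
    ‖φ f k‖ ≤ ‖f‖ := by
  have h1 : ∀ᵐ x ∂μ, 0 ≤ (((‖f‖ ^ 2 : ℝ) : ℂ) • (1 : LInfty μ) - star f * f) x := by
    filter_upwards [Lp.coeFn_sub (((‖f‖ ^ 2 : ℝ) : ℂ) • (1 : LInfty μ)) (star f * f),
      Lp.coeFn_smul ((‖f‖ ^ 2 : ℝ) : ℂ) (1 : LInfty μ), coeFn_one (μ := μ),
      coeFn_mul (star f) f, coeFn_star f, ae_norm_le_norm f] with x h1 h2 h3 h4 h5 h6
    rw [h1, Pi.sub_apply, h2, Pi.smul_apply, h3, h4, h5, smul_eq_mul, mul_one, Complex.star_def,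
      Complex.conj_mul', ← Complex.ofReal_pow, ← Complex.ofReal_sub]
    rw [Complex.zero_le_real, sub_nonneg]
    gcongr
  have h2 := hφ.nonneg _ h1 k
  rw [map_sub, map_smul, hφ.map_one] at h2
  have h3 := (Complex.nonneg_iff.1 h2).1
  simp only [Pi.sub_apply, Pi.smul_apply, Pi.one_apply, smul_eq_mul, mul_one, Complex.sub_re,
    Complex.ofReal_re] at h3
  exact le_of_sq_le_sq (by linarith [hφ.norm_sq_le f k]) (norm_nonneg f)

theorem IsUnitalPositive.norm2_sq_le (hφ : IsUnitalPositive φ) (f : LInfty μ) :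
    norm2 (φ f) ^ 2 ≤ (zeta (φ (star f * f))).re := by
  have h : (zeta (φ (star f * f))).re = (1 / (d : ℝ)) * ∑ k, (φ (star f * f) k).re := by
    have h1 : (1 / (d : ℂ)) = ((1 / (d : ℝ) : ℝ) : ℂ) := by push_cast; rfl
    rw [zeta, h1, Complex.re_ofReal_mul, Complex.re_sum]
  rw [norm2_sq, h]
  gcongr
  exact hφ.norm_sq_le f _

theorem IsUnitalPositive.comp (hφ : IsUnitalPositive φ) {θ : LInfty μ →ₗ[ℂ] LInfty μ}
    (h1 : θ 1 = 1) (hpos : ∀ f : LInfty μ, (∀ᵐ x ∂μ, 0 ≤ f x) → ∀ᵐ x ∂μ, 0 ≤ θ f x) :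
    IsUnitalPositive (φ ∘ₗ θ) where
  map_one := by rw [LinearMap.comp_apply, h1, hφ.map_one]
  nonneg f hf := hφ.nonneg _ (hpos f hf)

end UnitalPositive

/-! ### Null families of vectors -/

section Null

variable {ι : Type*} {l : Filter ι} {d : ι → ℕ}

/-- A family of vectors `v_x ∈ ℂ^{d_x}` is null along a filter when its normalized `ℓ²`-norms tend
to zero. -/
def IsNull (l : Filter ι) (v : ∀ x, Fin (d x) → ℂ) : Prop :=
  Tendsto (fun x => norm2 (v x)) l (𝓝 0)

theorem isNull_iff {v : ∀ x, Fin (d x) → ℂ} :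
    IsNull l v ↔ ∀ η : ℝ, 0 < η → ∀ᶠ x in l, norm2 (v x) < η := by
  rw [IsNull, Metric.tendsto_nhds]
  refine forall₂_congr fun η _ => eventually_congr (Eventually.of_forall fun x => ?_)
  rw [Real.dist_0_eq_abs, abs_of_nonneg (norm2_nonneg _)]

theorem IsNull.of_le {v : ∀ x, Fin (d x) → ℂ} {b : ι → ℝ} (hb : Tendsto b l (𝓝 0))
    (h : ∀ᶠ x in l, norm2 (v x) ≤ b x) : IsNull l v :=
  squeeze_zero' (Eventually.of_forall fun _ => norm2_nonneg _) h hb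

theorem IsNull.comp {v : ∀ x, Fin (d x) → ℂ} (hv : IsNull l v) {κ : Type*} {l' : Filter κ}
    {π : κ → ι} (hπ : Tendsto π l' l) :
    IsNull (d := fun y => d (π y)) l' fun y => v (π y) :=
  Tendsto.comp (g := fun x => norm2 (v x)) hv hπ

theorem isNull_zero : IsNull l fun x => (0 : Fin (d x) → ℂ) := by
  simp only [IsNull, norm2_zero]
  exact tendsto_const_nhds

theorem IsNull.congr {v w : ∀ x, Fin (d x) → ℂ} (hv : IsNull l v) (h : ∀ᶠ x in l, v x = w x) :
    IsNull l w :=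
  Tendsto.congr' (h.mono fun x hx => by rw [hx]) hv

theorem IsNull.add {v w : ∀ x, Fin (d x) → ℂ} (hv : IsNull l v) (hw : IsNull l w) :
    IsNull l fun x => v x + w x :=
  IsNull.of_le (by simpa using Tendsto.add hv hw) (Eventually.of_forall fun _ => norm2_add_le _ _)

theorem IsNull.neg {v : ∀ x, Fin (d x) → ℂ} (hv : IsNull l v) : IsNull l fun x => -v x := by
  simpa only [IsNull, norm2_neg] using hv

theorem IsNull.sub {v w : ∀ x, Fin (d x) → ℂ} (hv : IsNull l v) (hw : IsNull l w) :
    IsNull l fun x => v x - w x := by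
  simpa only [sub_eq_add_neg] using hv.add hw.neg

theorem IsNull.smul {v : ∀ x, Fin (d x) → ℂ} (c : ℂ) (hv : IsNull l v) :
    IsNull l fun x => c • v x := by
  simpa only [IsNull, norm2_smul, mul_zero] using Tendsto.const_mul ‖c‖ hv

theorem IsNull.bdd_mul {v w : ∀ x, Fin (d x) → ℂ} (hw : IsNull l w) {C : ℝ} (hC : 0 ≤ C)
    (hv : ∀ᶠ x in l, ∀ k, ‖v x k‖ ≤ C) : IsNull l fun x => v x * w x :=
  IsNull.of_le (by simpa using Tendsto.const_mul C hw) (hv.mono fun _ hx => norm2_mul_le hC hx)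

theorem IsNull.permAct {v : ∀ x, Fin (d x) → ℂ} (hv : IsNull l v)
    (τ : ∀ x, Equiv.Perm (Fin (d x))) : IsNull l fun x => permAct (τ x) (v x) := by
  simpa only [IsNull, norm2_permAct] using hv

end Null

/-! ### Asymptotics of approximately equivariant maps -/

section UPFilter

variable {G X : Type*} [Group G] [MulAction G X] [MeasurableSpace X] [MeasurableConstSMul G X]
  {μ : Measure X} [SMulInvariantMeasure G X μ]

theorem IsUP.mono {d : ℕ} {p : ℕ → LInfty μ} {F F' : Finset G} {m m' : ℕ} {δ δ' : ℝ}
    {σ : G → Equiv.Perm (Fin d)} {φ : LInfty μ →ₗ[ℂ] (Fin d → ℂ)} (h : IsUP p F m δ σ φ)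
    (hF : F' ⊆ F) (hm : m' ≤ m) (hδ : δ ≤ δ') : IsUP p F' m' δ' σ φ where
  unital_positive := h.unital_positive
  approx_mul j h1 hj a s := (h.approx_mul j h1 (hj.trans hm) (fun k => Fin.castLE hm (a k))
    fun k => ⟨s k, hF (s k).2⟩).trans_le hδ
  approx_state j h1 hj a s := (h.approx_state j h1 (hj.trans hm) (fun k => Fin.castLE hm (a k))
    fun k => ⟨s k, hF (s k).2⟩).trans_le hδ
  approx_equivariant s hs n :=
    (h.approx_equivariant s (hF hs) (Fin.castLE hm n)).trans_le hδ

variable {d : ℕ → ℕ}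

/-- The filter on pairs `(i, φ)`, `φ : L^∞(X, μ) → ℂ^{d_i}`, for which a property holds eventually
if, for some nonempty finite `F`, `m ≥ 1` and `δ > 0` and all large `i`, it holds on
`UP_μ(𝒮, F, m, δ, σ_i)`. -/
def upFilter (σ : ∀ i, G → Equiv.Perm (Fin (d i))) (p : ℕ → LInfty μ) :
    Filter (Σ i, LInfty μ →ₗ[ℂ] (Fin (d i) → ℂ)) where
  sets := {S | ∃ (F : Finset G) (m : ℕ) (δ : ℝ) (I : ℕ), F.Nonempty ∧ 1 ≤ m ∧ 0 < δ ∧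
    ∀ i ≥ I, ∀ φ : LInfty μ →ₗ[ℂ] (Fin (d i) → ℂ), IsUP p F m δ (σ i) φ → ⟨i, φ⟩ ∈ S}
  univ_sets := ⟨{1}, 1, 1, 0, by simp, le_rfl, one_pos, fun _ _ _ _ => trivial⟩
  sets_of_superset := by
    rintro S T ⟨F, m, δ, I, hF, hm, hδ, h⟩ hST
    exact ⟨F, m, δ, I, hF, hm, hδ, fun i hi φ hφ => hST (h i hi φ hφ)⟩
  inter_sets := by
    classical
    rintro S T ⟨F, m, δ, I, hF, hm, hδ, h⟩ ⟨F', m', δ', I', hF', hm', hδ', h'⟩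
    refine ⟨F ∪ F', max m m', min δ δ', max I I', hF.mono Finset.subset_union_left,
      hm.trans (le_max_left _ _), lt_min hδ hδ', fun i hi φ hφ => ⟨?_, ?_⟩⟩
    · exact h i ((le_max_left _ _).trans hi) φ
        (hφ.mono Finset.subset_union_left (le_max_left _ _) (min_le_left _ _))
    · exact h' i ((le_max_right _ _).trans hi) φ
        (hφ.mono Finset.subset_union_right (le_max_right _ _) (min_le_right _ _))

variable {σ : ∀ i, G → Equiv.Perm (Fin (d i))} {p : ℕ → LInfty μ}

theorem eventually_upFilter_iff {Q : (Σ i, LInfty μ →ₗ[ℂ] (Fin (d i) → ℂ)) → Prop} :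
    (∀ᶠ x in upFilter σ p, Q x) ↔
      ∃ (F : Finset G) (m : ℕ) (δ : ℝ) (I : ℕ), F.Nonempty ∧ 1 ≤ m ∧ 0 < δ ∧
        ∀ i ≥ I, ∀ φ : LInfty μ →ₗ[ℂ] (Fin (d i) → ℂ), IsUP p F m δ (σ i) φ → Q ⟨i, φ⟩ :=
  Iff.rfl

theorem eventually_isUP (F : Finset G) (m : ℕ) {δ : ℝ} (hδ : 0 < δ) :
    ∀ᶠ x in upFilter σ p, IsUP p F m δ (σ x.1) x.2 := by
  classical
  exact ⟨insert 1 F, max 1 m, δ, 0, Finset.insert_nonempty _ _, le_max_left _ _, hδ,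
    fun i _ φ hφ => hφ.mono (Finset.subset_insert _ _) (le_max_right _ _) le_rfl⟩

theorem tendsto_fst_upFilter : Tendsto Sigma.fst (upFilter σ p) atTop := by
  rw [tendsto_atTop]
  exact fun I => ⟨{1}, 1, 1, I, by simp, le_rfl, one_pos, fun i hi _ _ => hi⟩

theorem eventually_unitalPositive : ∀ᶠ x in upFilter σ p, IsUnitalPositive x.2 :=
  (eventually_isUP ∅ 0 one_pos).mono fun _ h => h.unital_positive

/-- The product `∏ α_s(p_n)` over a list of pairs `(s, n)`. -/
def wordProd (p : ℕ → LInfty μ) (z : List (G × ℕ)) : LInfty μ :=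
  (z.map fun y => alpha y.1 (p y.2)).prod

theorem wordProd_append (p : ℕ → LInfty μ) (z w : List (G × ℕ)) :
    wordProd p (z ++ w) = wordProd p z * wordProd p w := by
  simp [wordProd]

variable (p) in
/-- The defining conditions on products, for arbitrary lists of translates. -/
theorem eventually_word (z : List (G × ℕ)) (hz : z ≠ []) {δ : ℝ} (hδ : 0 < δ) :
    ∀ᶠ x in upFilter σ p,
      norm2 (x.2 (wordProd p z) - (z.map fun y => x.2 (alpha y.1 (p y.2))).prod) < δ ∧
      ‖zeta (x.2 (wordProd p z)) - ∫ x, wordProd p z x ∂μ‖ < δ := by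
  classical
  set F : Finset G := (z.map Prod.fst).toFinset
  set m : ℕ := z.length + ((z.map Prod.snd).sum + 1)
  have hF : ∀ k : Fin z.length, (z.get k).1 ∈ F := fun k =>
    List.mem_toFinset.2 (List.mem_map_of_mem (List.get_mem z k))
  have hm : ∀ k : Fin z.length, (z.get k).2 < m := fun k => by
    have : (z.get k).2 ≤ (z.map Prod.snd).sum :=
      List.le_sum_of_mem (List.mem_map_of_mem (List.get_mem z k))
    omega
  filter_upwards [eventually_isUP F m hδ] with x hx
  have h1 : 1 ≤ z.length := List.length_pos_iff.2 hz
  have h2 := hx.approx_mul z.length h1 (Nat.le_add_right _ _) (fun k => ⟨_, hm k⟩)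
    fun k => ⟨_, hF k⟩
  have h3 := hx.approx_state z.length h1 (Nat.le_add_right _ _) (fun k => ⟨_, hm k⟩)
    fun k => ⟨_, hF k⟩
  have h4 : ∏ k : Fin z.length, alpha (z.get k).1 (p (z.get k).2) = wordProd p z :=
    Fin.prod_univ_fun_getElem z fun y => alpha y.1 (p y.2)
  have h5 : ∏ k : Fin z.length, x.2 (alpha (z.get k).1 (p (z.get k).2)) =
      (z.map fun y => x.2 (alpha y.1 (p y.2))).prod :=
    Fin.prod_univ_fun_getElem z fun y => x.2 (alpha y.1 (p y.2))
  simp only [h4, h5] at h2 h3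
  exact ⟨h2, h3⟩

variable (G) in
/-- The algebra generated by the translates is the linear span of their products. -/
theorem genAlg_induction {P : LInfty μ → Prop} (hword : ∀ z : List (G × ℕ), P (wordProd p z))
    (hadd : ∀ f g, P f → P g → P (f + g)) (hsmul : ∀ (c : ℂ) f, P f → P (c • f))
    {f : LInfty μ} (hf : f ∈ genAlg G p) : P f := by
  rw [genAlg, ← Subalgebra.mem_toSubmodule, Algebra.adjoin_eq_span] at hf
  induction hf using Submodule.span_induction with
  | mem f hf =>
    obtain ⟨L, hL, rfl⟩ := Submonoid.exists_list_of_mem_closure hf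
    obtain ⟨z, rfl⟩ : ∃ z : List (G × ℕ), z.map (fun y => alpha y.1 (p y.2)) = L := by
      rw [← Set.mem_range, Set.range_list_map]
      exact hL
    exact hword z
  | zero => simpa using hsmul 0 _ (hword [])
  | add f g _ _ h1 h2 => exact hadd f g h1 h2
  | smul c f _ h => exact hsmul c f h

theorem IsUnitalPositive.norm_list_prod_le {d : ℕ} {φ : LInfty μ →ₗ[ℂ] (Fin d → ℂ)}
    (hφ : IsUnitalPositive φ) (hp : IsRealUnitBallSeq p) (z : List (G × ℕ)) (k : Fin d) :
    ‖(z.map fun y => φ (alpha y.1 (p y.2))).prod k‖ ≤ 1 := by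
  induction z with
  | nil => simp
  | cons y z ih =>
    rw [List.map_cons, List.prod_cons, Pi.mul_apply, norm_mul]
    refine mul_le_one₀ ((hφ.norm_apply_le _ k).trans ?_) (norm_nonneg _) ih
    rw [norm_alpha]
    exact (hp _).1

theorem isNull_word (z : List (G × ℕ)) : IsNull (upFilter σ p) fun x =>
    x.2 (wordProd p z) - (z.map fun y => x.2 (alpha y.1 (p y.2))).prod := by
  by_cases hz : z = []
  · subst hz
    refine isNull_zero.congr ?_
    filter_upwards [eventually_unitalPositive] with x hx
    simp [wordProd, hx.map_one]
  · exact isNull_iff.2 fun η hη => (eventually_word p z hz hη).mono fun _ h => h.1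

/-- Along the filter the maps are asymptotically multiplicative on the generated algebra. -/
theorem isNull_mul (hp : IsRealUnitBallSeq p) {f g : LInfty μ} (hf : f ∈ genAlg G p)
    (hg : g ∈ genAlg G p) :
    IsNull (upFilter σ p) fun x => x.2 (f * g) - x.2 f * x.2 g := by
  refine genAlg_induction G (P := fun f => IsNull (upFilter σ p) fun x =>
    x.2 (f * g) - x.2 f * x.2 g) (fun z => ?_) (fun f f' h h' => ?_) (fun c f h => ?_) hf
  · refine genAlg_induction G (P := fun g => IsNull (upFilter σ p) fun x =>
      x.2 (wordProd p z * g) - x.2 (wordProd p z) * x.2 g) (fun w => ?_) (fun f f' h h' => ?_)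
      (fun c f h => ?_) hg
    · have h1 := isNull_word (σ := σ) (p := p) (z ++ w)
      have h2 := (isNull_word (σ := σ) (p := p) w).bdd_mul zero_le_one
        (eventually_unitalPositive.mono fun x hx => hx.norm_list_prod_le hp z)
      have h3 := (isNull_word (σ := σ) (p := p) z).bdd_mul (norm_nonneg (wordProd p w))
        (eventually_unitalPositive.mono fun x hx => hx.norm_apply_le (wordProd p w))
      refine ((h1.sub h2).sub h3).congr (Eventually.of_forall fun x => ?_)
      rw [wordProd_append, List.map_append, List.prod_append]
      ring
    · refine (h.add h').congr (Eventually.of_forall fun x => ?_)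
      rw [mul_add, map_add, map_add]
      ring
    · refine (h.smul c).congr (Eventually.of_forall fun x => ?_)
      rw [mul_smul_comm, map_smul, map_smul, mul_smul_comm, smul_sub]
  · refine (h.add h').congr (Eventually.of_forall fun x => ?_)
    rw [add_mul, map_add, map_add]
    ring
  · refine (h.smul c).congr (Eventually.of_forall fun x => ?_)
    rw [smul_mul_assoc, map_smul, map_smul, smul_mul_assoc, smul_sub]

/-- Along the filter the maps are asymptotically state preserving on the generated algebra. -/
theorem tendsto_zeta [IsProbabilityMeasure μ] (hσ : IsSoficApproximation d σ) {f : LInfty μ} (hf : f ∈ genAlg G p) :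
    Tendsto (fun x => zeta (x.2 f)) (upFilter σ p) (𝓝 (∫ x, f x ∂μ)) := by
  refine genAlg_induction G (P := fun f => Tendsto (fun x => zeta (x.2 f)) (upFilter σ p)
    (𝓝 (∫ x, f x ∂μ))) (fun z => ?_) (fun f g hf hg => ?_) (fun c f hf => ?_) hf
  · by_cases hz : z = []
    · subst hz
      refine Tendsto.congr' (f₁ := fun _ => 1) ?_ ?_
      · filter_upwards [eventually_unitalPositive] with x hx
        simp [wordProd, hx.map_one, zeta_one (hσ.pos x.1)]
      · have : ∫ x, (1 : LInfty μ) x ∂μ = 1 := by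
          rw [integral_congr_ae coeFn_one]
          simp
        simp only [wordProd, List.map_nil, List.prod_nil, this]
        exact tendsto_const_nhds
    · rw [Metric.tendsto_nhds]
      intro η hη
      filter_upwards [eventually_word p z hz hη] with x hx
      rw [dist_eq_norm]
      exact hx.2
  · rw [integral_congr_ae (Lp.coeFn_add f g)]
    simp only [Pi.add_apply, map_add, zeta_add]
    rw [integral_add (integrable_LInfty f) (integrable_LInfty g)]
    exact hf.add hg
  · rw [integral_congr_ae (Lp.coeFn_smul c f)]
    simp only [Pi.smul_apply, map_smul, zeta_smul, smul_eq_mul, integral_const_mul]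
    exact hf.const_mul c

/-- Along the filter the maps are asymptotically `L²`-contractive on the generated algebra. -/
theorem eventually_norm2_lt [IsProbabilityMeasure μ] (hσ : IsSoficApproximation d σ)
    (hp : IsRealUnitBallSeq p)
    {f : LInfty μ} (hf : f ∈ genAlg G p) {c : ℝ} (hc : ‖toL2 μ f‖ < c) :
    ∀ᶠ x in upFilter σ p, norm2 (x.2 f) < c := by
  have h1 := tendsto_zeta (σ := σ) hσ (mul_mem (star_mem_genAlg hp hf) hf)
  rw [integral_star_mul_self] at h1
  have h2 := (Complex.continuous_re.tendsto _).comp h1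
  have h3 : ‖toL2 μ f‖ ^ 2 < c ^ 2 := by gcongr
  filter_upwards [h2.eventually_lt_const h3, eventually_unitalPositive] with x h4 h5
  exact lt_of_pow_lt_pow_left₀ 2 ((norm_nonneg _).trans hc.le) ((h5.norm2_sq_le f).trans_lt h4)

theorem isNull_permAct_mul (hσ : IsSoficApproximation d σ) (s t : G) {f : LInfty μ} :
    IsNull (upFilter σ p) fun x =>
      permAct (σ x.1 (s * t)) (x.2 f) - permAct (σ x.1 s) (permAct (σ x.1 t) (x.2 f)) := by
  have h1 : Tendsto (fun x : Σ i, LInfty μ →ₗ[ℂ] (Fin (d i) → ℂ) => Real.sqrt ((2 * ‖f‖) ^ 2 *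
      (1 - (1 / (d x.1 : ℝ)) * (Finset.univ.filter fun k =>
        σ x.1 (s * t) k = (σ x.1 s * σ x.1 t) k).card))) (upFilter σ p) (𝓝 0) := by
    have h2 := (((hσ.asymptotically_mul s t).const_sub 1).const_mul ((2 * ‖f‖) ^ 2)).sqrt
    rw [sub_self, mul_zero, Real.sqrt_zero] at h2
    exact h2.comp tendsto_fst_upFilter
  refine IsNull.of_le h1 ?_
  filter_upwards [eventually_unitalPositive] with x hx
  rw [← permAct_mul_apply]
  exact Real.le_sqrt_of_sq_le (norm2_permAct_sub_sq_le (hσ.pos x.1) _ _ (hx.norm_apply_le f))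

/-- Along the filter the maps are asymptotically equivariant on the generators. -/
theorem isNull_equivariant_seq (s : G) (n : ℕ) :
    IsNull (upFilter σ p) fun x => x.2 (alpha s (p n)) - permAct (σ x.1 s) (x.2 (p n)) :=
  isNull_iff.2 fun _ hη => (eventually_isUP {s} (n + 1) hη).mono fun _ h =>
    h.approx_equivariant s (Finset.mem_singleton_self s) ⟨n, n.lt_succ_self⟩

/-- Along the filter the maps are asymptotically equivariant on the generated algebra. -/
theorem isNull_equivariant (hσ : IsSoficApproximation d σ) (hp : IsRealUnitBallSeq p) (t : G)
    {f : LInfty μ} (hf : f ∈ genAlg G p) :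
    IsNull (upFilter σ p) fun x => x.2 (alpha t f) - permAct (σ x.1 t) (x.2 f) := by
  induction hf using Algebra.adjoin_induction with
  | mem f hf =>
    obtain ⟨⟨s, n⟩, rfl⟩ := hf
    have h1 := isNull_equivariant_seq (σ := σ) (p := p) (t * s) n
    have h2 := isNull_permAct_mul (p := p) hσ t s (f := p n)
    have h3 := (isNull_equivariant_seq (σ := σ) (p := p) s n).permAct fun x => σ x.1 t
    refine ((h1.add h2).sub h3).congr (Eventually.of_forall fun x => ?_)
    simp only [alpha_alpha, permAct_sub]
    ring
  | algebraMap c =>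
    refine isNull_zero.congr ?_
    filter_upwards [eventually_unitalPositive] with x hx
    rw [← alphaHom_apply, AlgHom.commutes, Algebra.algebraMap_eq_smul_one, map_smul, hx.map_one]
    exact (sub_self _).symm
  | add f g _ _ h1 h2 =>
    refine (h1.add h2).congr (Eventually.of_forall fun x => ?_)
    rw [← alphaHom_apply, ← alphaHom_apply, ← alphaHom_apply, map_add, map_add, map_add]
    funext k
    simp only [permAct, Pi.add_apply, Pi.sub_apply]
    ring
  | mul f g hf hg h1 h2 =>
    have h3 := isNull_mul (σ := σ) hp (alpha_mem_genAlg t hf) (alpha_mem_genAlg t hg)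
    have h4 := (isNull_mul (σ := σ) hp hf hg).permAct fun x => σ x.1 t
    have h5 := h2.bdd_mul (norm_nonneg (alpha t f))
      (eventually_unitalPositive.mono fun x hx => hx.norm_apply_le (alpha t f))
    have hb : ∀ᶠ x in upFilter σ p, ∀ k, ‖permAct (σ x.1 t) (x.2 g) k‖ ≤ ‖g‖ :=
      eventually_unitalPositive.mono fun x hx k => hx.norm_apply_le g _
    have h6 := h1.bdd_mul (norm_nonneg g) hb
    refine (((h3.sub h4).add h5).add h6).congr (Eventually.of_forall fun x => ?_)
    rw [show alpha t (f * g) = alpha t f * alpha t g from map_mul (alphaHom t) f g]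
    funext k
    simp only [permAct, Pi.add_apply, Pi.sub_apply, Pi.mul_apply]
    ring

end UPFilter

/-! ### Passing from one sequence to another -/

section Transfer

variable {G X : Type*} [Group G] [MulAction G X] [MeasurableSpace X] [MeasurableConstSMul G X]
  {μ : Measure X} [SMulInvariantMeasure G X μ] {d : ℕ → ℕ} {σ : ∀ i, G → Equiv.Perm (Fin (d i))}
  {p q : ℕ → LInfty μ}

theorem isNull_prod (hp : IsRealUnitBallSeq p) {ι : Type*} (s : Finset ι) {f : ι → LInfty μ}
    (hf : ∀ i, f i ∈ genAlg G p) :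
    IsNull (upFilter σ p) fun x => x.2 (∏ i ∈ s, f i) - ∏ i ∈ s, x.2 (f i) := by
  classical
  induction s using Finset.induction_on with
  | empty =>
    refine isNull_zero.congr (eventually_unitalPositive.mono fun x hx => ?_)
    simp [hx.map_one]
  | insert i s hi ih =>
    have h1 := isNull_mul (σ := σ) hp (hf i) (prod_mem (t := s) fun j _ => hf j)
    have h2 := ih.bdd_mul (norm_nonneg (f i))
      (eventually_unitalPositive.mono fun x hx => hx.norm_apply_le (f i))
    refine (h1.add h2).congr (Eventually.of_forall fun x => ?_)
    rw [Finset.prod_insert hi, Finset.prod_insert hi]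
    ring

variable [IsProbabilityMeasure μ]

/-- If `f` is `L²`-small and `v_x` is null then `φ(f) + v_x` is eventually small. -/
theorem eventually_norm2_add_lt (hσ : IsSoficApproximation d σ) (hp : IsRealUnitBallSeq p)
    {f : LInfty μ} (hf : f ∈ genAlg G p) {c : ℝ} (hc : ‖toL2 μ f‖ < c)
    {v : ∀ x : Σ i, LInfty μ →ₗ[ℂ] (Fin (d i) → ℂ), Fin (d x.1) → ℂ}
    (hv : IsNull (upFilter σ p) v) :
    ∀ᶠ x in upFilter σ p, norm2 (x.2 f + v x) < c := by
  obtain ⟨c', h1, h2⟩ := exists_between hc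
  filter_upwards [eventually_norm2_lt hσ hp hf h1, isNull_iff.1 hv (c - c') (by linarith)]
    with x h3 h4
  exact (norm2_add_le _ _).trans_lt (by linarith)

/-- Composition with a smoothing into the algebra of the sequence `p` turns
elements of `UP_μ(p, …)` into elements of `UP_μ(q, …)`, for any other sequence `q`. -/
theorem exists_isSmoothing_isUP (hσ : IsSoficApproximation d σ) (hp : IsRealUnitBallSeq p)
    (hgen : IsDynamicallyGenerating G (Set.range p)) (hq : IsRealUnitBallSeq q)
    (F : Finset G) (m : ℕ) {δ : ℝ} (hδ : 0 < δ) {Φ : Set (LInfty μ)} (hΦ : Φ.Finite)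
    {η : ℝ} (hη : 0 < η) :
    ∃ θ : LInfty μ →ₗ[ℂ] LInfty μ, IsSmoothing G p θ ∧ (∀ f ∈ Φ, ‖toL2 μ (θ f - f)‖ < η) ∧
      ∀ᶠ x in upFilter σ p, IsUP q F m δ (σ x.1) (x.2 ∘ₗ θ) := by
  set κ : ℝ := min η (δ / (m + 2)) with hκ
  have hκ0 : 0 < κ := lt_min hη (by positivity)
  have hκδ : (m + 2) * κ ≤ δ := by
    have : κ ≤ δ / (m + 2) := min_le_right _ _
    rwa [le_div_iff₀ (by positivity), mul_comm] at this
  have hm0 : (0 : ℝ) ≤ m := Nat.cast_nonneg m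
  set W : Set (LInfty μ) := ⋃ j ∈ Set.Iic m, Set.range fun z : (Fin j → Fin m) × (Fin j → F) =>
    ∏ k, alpha (z.2 k : G) (q (z.1 k))
  set A : Set (LInfty μ) := Set.range fun z : F × Fin m => alpha (z.1 : G) (q z.2)
  set Q : Set (LInfty μ) := Set.range fun n : Fin m => q n
  have hfin : (Φ ∪ W ∪ A ∪ Q).Finite :=
    ((hΦ.union ((Set.finite_Iic m).biUnion fun j _ => Set.finite_range _)).union
      (Set.finite_range _)).union (Set.finite_range _)
  obtain ⟨θ, hθ, hnear⟩ := exists_isSmoothing_near hp hgen hfin hκ0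
  have hW : ∀ j, j ≤ m → ∀ (a : Fin j → Fin m) (s : Fin j → F),
      ‖toL2 μ (θ (∏ k, alpha (s k : G) (q (a k))) - ∏ k, alpha (s k : G) (q (a k)))‖ < κ :=
    fun j hj a s => hnear _ (Or.inl (Or.inl (Or.inr
      (Set.mem_biUnion (Set.mem_Iic.2 hj) ⟨(a, s), rfl⟩))))
  have hA : ∀ (s : F) (n : Fin m),
      ‖toL2 μ (θ (alpha (s : G) (q n)) - alpha (s : G) (q n))‖ < κ :=
    fun s n => hnear _ (Or.inl (Or.inr ⟨(s, n), rfl⟩))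
  have hQ : ∀ n : Fin m, ‖toL2 μ (θ (q n) - q n)‖ < κ := fun n => hnear _ (Or.inr ⟨n, rfl⟩)
  have hq1 : ∀ (s : G) (n : ℕ), ‖alpha s (q n)‖ ≤ 1 := fun s n => by
    rw [norm_alpha]
    exact (hq n).1
  refine ⟨θ, hθ, fun f hf => (hnear f (Or.inl (Or.inl (Or.inl hf)))).trans_le (min_le_left _ _), ?_⟩
  have hmul : ∀ᶠ x in upFilter σ p, ∀ j ∈ Set.Iic m, ∀ (a : Fin j → Fin m) (s : Fin j → F),
      norm2 ((x.2 ∘ₗ θ) (∏ k, alpha (s k : G) (q (a k))) -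
        ∏ k, (x.2 ∘ₗ θ) (alpha (s k : G) (q (a k)))) < δ := by
    refine (eventually_all_finite (Set.finite_Iic m)).2 fun j hj =>
      eventually_all.2 fun a => eventually_all.2 fun s => ?_
    have hmem : ∀ k, θ (alpha (s k : G) (q (a k))) ∈ genAlg G p := fun k => hθ.mem _
    have h1 : ‖toL2 μ (θ (∏ k, alpha (s k : G) (q (a k))) -
        ∏ k, θ (alpha (s k : G) (q (a k))))‖ < δ := by
      have h2 := norm_toL2_prod_sub_prod_le Finset.univ
        (f := fun k => alpha (s k : G) (q (a k))) (g := fun k => θ (alpha (s k : G) (q (a k))))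
        (fun k _ => hq1 _ _) (fun k _ => (hθ.norm_le _).trans (hq1 _ _))
      have h3 : ∑ k, ‖toL2 μ (alpha (s k : G) (q (a k)) - θ (alpha (s k : G) (q (a k))))‖ ≤
          m * κ := by
        refine (Finset.sum_le_card_nsmul _ _ κ fun k _ => ?_).trans ?_
        · rw [map_sub, norm_sub_rev, ← map_sub]
          exact (hA _ _).le
        · rw [Finset.card_univ, Fintype.card_fin, nsmul_eq_mul]
          gcongr
          exact hj
      rw [← sub_add_sub_cancel _ (∏ k, alpha (s k : G) (q (a k))), map_add]
      refine (norm_add_le _ _).trans_lt ?_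
      linarith [hW j hj a s]
    refine (eventually_norm2_add_lt hσ hp
      (sub_mem (hθ.mem _) (prod_mem fun k _ => hmem k)) h1
      (isNull_prod hp Finset.univ hmem)).mono fun x hx => ?_
    rwa [map_sub, sub_add_sub_cancel] at hx
  have hstate : ∀ᶠ x in upFilter σ p, ∀ j ∈ Set.Iic m, ∀ (a : Fin j → Fin m) (s : Fin j → F),
      ‖zeta ((x.2 ∘ₗ θ) (∏ k, alpha (s k : G) (q (a k)))) -
        ∫ x, (∏ k, alpha (s k : G) (q (a k)) : LInfty μ) x ∂μ‖ < δ := by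
    refine (eventually_all_finite (Set.finite_Iic m)).2 fun j hj =>
      eventually_all.2 fun a => eventually_all.2 fun s => ?_
    have h1 := (tendsto_zeta (σ := σ) hσ (hθ.mem (∏ k, alpha (s k : G) (q (a k))))).sub_const
      (∫ x, (∏ k, alpha (s k : G) (q (a k)) : LInfty μ) x ∂μ)
    refine h1.norm.eventually_lt_const ?_
    rw [← integral_sub (integrable_LInfty _) (integrable_LInfty _)]
    have h2 := norm_integral_le
      (θ (∏ k, alpha (s k : G) (q (a k))) - ∏ k, alpha (s k : G) (q (a k)))
    rw [integral_congr_ae (Lp.coeFn_sub _ _)] at h2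
    exact (h2.trans_lt (hW j hj a s)).trans_le (by nlinarith)
  have hequi : ∀ᶠ x in upFilter σ p, ∀ s : F, ∀ n : Fin m,
      norm2 ((x.2 ∘ₗ θ) (alpha (s : G) (q n)) - permAct (σ x.1 s) ((x.2 ∘ₗ θ) (q n))) < δ := by
    refine eventually_all.2 fun s => eventually_all.2 fun n => ?_
    have h1 : ‖toL2 μ (θ (alpha (s : G) (q n)) - alpha (s : G) (θ (q n)))‖ < δ := by
      rw [← sub_add_sub_cancel _ (alpha (s : G) (q n)), map_add]
      refine (norm_add_le _ _).trans_lt ?_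
      have h2 : ‖toL2 μ (alpha (s : G) (q n) - alpha (s : G) (θ (q n)))‖ < κ := by
        have h3 : alpha (s : G) (q n) - alpha (s : G) (θ (q n)) =
          alpha (s : G) (q n - θ (q n)) := (map_sub (alphaHom (s : G)) _ _).symm
        rw [h3, norm_toL2_alpha, map_sub, norm_sub_rev, ← map_sub]
        exact hQ n
      nlinarith [hA s n]
    refine (eventually_norm2_add_lt hσ hp
      (sub_mem (hθ.mem _) (alpha_mem_genAlg _ (hθ.mem _))) h1
      (isNull_equivariant hσ hp (s : G) (hθ.mem (q n)))).mono fun x hx => ?_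
    rwa [map_sub, sub_add_sub_cancel] at hx
  filter_upwards [eventually_unitalPositive, hmul, hstate, hequi] with x h1 h2 h3 h4
  exact ⟨h1.comp hθ.map_one hθ.nonneg, fun j _ hj => h2 j hj, fun j _ hj => h3 j hj,
    fun s hs => h4 ⟨s, hs⟩⟩

end Transfer

/-! ### The pseudometric -/

section Rho

variable {X : Type*} [MeasurableSpace X] {μ : Measure X} {d : ℕ} {p : ℕ → LInfty μ}
  {φ ψ : LInfty μ →ₗ[ℂ] (Fin d → ℂ)}

theorem norm2_map_sub_map_le (hp : IsRealUnitBallSeq p) (hφ : IsUnitalPositive φ)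
    (hψ : IsUnitalPositive ψ) (n : ℕ) : norm2 (φ (p n) - ψ (p n)) ≤ 2 := by
  refine norm2_le_of_bound zero_le_two fun k => ?_
  rw [Pi.sub_apply]
  have h1 := (hφ.norm_apply_le (p n) k).trans (hp n).1
  have h2 := (hψ.norm_apply_le (p n) k).trans (hp n).1
  exact (norm_sub_le _ _).trans (by linarith)

theorem rho_term_nonneg (n : ℕ) : 0 ≤ (1 / 2 ^ (n + 1) : ℝ) * norm2 (φ (p n) - ψ (p n)) :=
  mul_nonneg (by positivity) (norm2_nonneg _)

theorem rho_nonneg : 0 ≤ rho p φ ψ := tsum_nonneg rho_term_nonneg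

theorem rho_self : rho p φ φ = 0 := by
  simp [rho, norm2_zero]

theorem rho_term_le {c : ℝ} {n : ℕ} (h : norm2 (φ (p n) - ψ (p n)) ≤ c) :
    (1 / 2 ^ (n + 1) : ℝ) * norm2 (φ (p n) - ψ (p n)) ≤ c / 2 / 2 ^ n := by
  have h1 : c / 2 / 2 ^ n = (1 / 2 ^ (n + 1) : ℝ) * c := by
    rw [pow_succ]
    field_simp
  rw [h1]
  gcongr

theorem summable_rho (hp : IsRealUnitBallSeq p) (hφ : IsUnitalPositive φ)
    (hψ : IsUnitalPositive ψ) :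
    Summable fun n : ℕ => (1 / 2 ^ (n + 1) : ℝ) * norm2 (φ (p n) - ψ (p n)) :=
  Summable.of_nonneg_of_le rho_term_nonneg
    (fun n => rho_term_le (norm2_map_sub_map_le hp hφ hψ n)) (summable_geometric_two' 2)

theorem norm2_le_rho (hp : IsRealUnitBallSeq p) (hφ : IsUnitalPositive φ)
    (hψ : IsUnitalPositive ψ) (n : ℕ) :
    norm2 (φ (p n) - ψ (p n)) ≤ 2 ^ (n + 1) * rho p φ ψ := by
  have h := (summable_rho hp hφ hψ).le_tsum n fun k _ => rho_term_nonneg k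
  rw [one_div_mul_eq_div, div_le_iff₀ (by positivity), mul_comm] at h
  exact h

/-- Maps at `ρ`-distance more than `ε` differ by more than `ε / 2` at one of the first members of
the sequence, whose number depends on `ε` only. -/
theorem exists_separating_index (hp : IsRealUnitBallSeq p) {ε : ℝ} (hε : 0 < ε) :
    ∃ R : ℕ, ∀ (d : ℕ) (φ ψ : LInfty μ →ₗ[ℂ] (Fin d → ℂ)), IsUnitalPositive φ →
      IsUnitalPositive ψ → ε < rho p φ ψ → ∃ n < R, ε / 2 < norm2 (φ (p n) - ψ (p n)) := by
  have htail := tendsto_sum_nat_add fun n : ℕ => (2 : ℝ) / 2 / 2 ^ n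
  obtain ⟨R, hR⟩ := (htail.eventually_lt_const (half_pos hε)).exists
  refine ⟨R, fun d φ ψ hφ hψ h => ?_⟩
  by_contra! hcon
  refine h.not_ge ?_
  have hs := summable_rho hp hφ hψ
  rw [rho, ← hs.sum_add_tsum_nat_add R]
  have h1 : ∑ n ∈ Finset.range R, (1 / 2 ^ (n + 1) : ℝ) * norm2 (φ (p n) - ψ (p n)) ≤ ε / 2 := by
    refine (Finset.sum_le_sum fun n hn =>
      rho_term_le (hcon n (Finset.mem_range.1 hn))).trans ?_
    refine ((summable_geometric_two' (ε / 2)).sum_le_tsum _ fun n _ => by positivity).trans ?_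
    rw [tsum_geometric_two']
  have h2 : ∑' n, (1 / 2 ^ (n + R + 1) : ℝ) * norm2 (φ (p (n + R)) - ψ (p (n + R))) ≤
      ∑' n, (2 : ℝ) / 2 / 2 ^ (n + R) :=
    ((summable_nat_add_iff R).2 hs).tsum_le_tsum
      (fun n => rho_term_le (norm2_map_sub_map_le hp hφ hψ _))
      ((summable_nat_add_iff R).2 (summable_geometric_two' 2))
  linarith

end Rho

/-! ### Pairs of close maps -/

section Pairs

variable {G X : Type*} [Group G] [MulAction G X] [MeasurableSpace X] [MeasurableConstSMul G X]
  {μ : Measure X} [SMulInvariantMeasure G X μ] {d : ℕ → ℕ} {σ : ∀ i, G → Equiv.Perm (Fin (d i))}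
  {q : ℕ → LInfty μ}

/-- The filter on triples `(i, φ, ψ)` describing pairs of elements of the sets
`UP_μ(𝒮, F, m, δ, σ_i)` with `ρ_𝒮(φ, ψ)` tending to zero. -/
def pairFilter (σ : ∀ i, G → Equiv.Perm (Fin (d i))) (q : ℕ → LInfty μ) :
    Filter (Σ i, (LInfty μ →ₗ[ℂ] (Fin (d i) → ℂ)) × (LInfty μ →ₗ[ℂ] (Fin (d i) → ℂ))) :=
  comap (fun y => ⟨y.1, y.2.1⟩) (upFilter σ q) ⊓ comap (fun y => ⟨y.1, y.2.2⟩) (upFilter σ q) ⊓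
    comap (fun y => rho q y.2.1 y.2.2) (𝓝 0)

theorem tendsto_pairFilter_fst : Tendsto (fun y : Σ i, (LInfty μ →ₗ[ℂ] (Fin (d i) → ℂ)) ×
    (LInfty μ →ₗ[ℂ] (Fin (d i) → ℂ)) =>
      (⟨y.1, y.2.1⟩ : Σ i, LInfty μ →ₗ[ℂ] (Fin (d i) → ℂ))) (pairFilter σ q) (upFilter σ q) :=
  tendsto_comap.mono_left (inf_le_left.trans inf_le_left)

theorem tendsto_pairFilter_snd : Tendsto (fun y : Σ i, (LInfty μ →ₗ[ℂ] (Fin (d i) → ℂ)) ×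
    (LInfty μ →ₗ[ℂ] (Fin (d i) → ℂ)) =>
      (⟨y.1, y.2.2⟩ : Σ i, LInfty μ →ₗ[ℂ] (Fin (d i) → ℂ))) (pairFilter σ q) (upFilter σ q) :=
  tendsto_comap.mono_left (inf_le_left.trans inf_le_right)

theorem tendsto_pairFilter_rho :
    Tendsto (fun y => rho q y.2.1 y.2.2) (pairFilter σ q) (𝓝 0) :=
  tendsto_comap.mono_left inf_le_right

/-- Maps that are close on the sequence are close on the algebra generated by its translates. -/
theorem isNull_pair_sub (hq : IsRealUnitBallSeq q) {f : LInfty μ} (hf : f ∈ genAlg G q) :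
    IsNull (pairFilter σ q) fun y => y.2.1 f - y.2.2 f := by
  have hpos : ∀ᶠ y in pairFilter σ q, IsUnitalPositive y.2.1 ∧ IsUnitalPositive y.2.2 :=
    (tendsto_pairFilter_fst.eventually eventually_unitalPositive).and
      (tendsto_pairFilter_snd.eventually eventually_unitalPositive)
  induction hf using Algebra.adjoin_induction with
  | mem f hf =>
    obtain ⟨⟨s, n⟩, rfl⟩ := hf
    have h1 := (isNull_equivariant_seq s n).comp (tendsto_pairFilter_fst (σ := σ) (q := q))
    have h2 := (isNull_equivariant_seq s n).comp (tendsto_pairFilter_snd (σ := σ) (q := q))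
    have h3 : IsNull (pairFilter σ q) fun y => y.2.1 (q n) - y.2.2 (q n) := by
      refine IsNull.of_le (b := fun y => 2 ^ (n + 1) * rho q y.2.1 y.2.2) ?_
        (hpos.mono fun y hy => norm2_le_rho hq hy.1 hy.2 n)
      simpa using tendsto_pairFilter_rho.const_mul ((2 : ℝ) ^ (n + 1))
    refine ((h1.sub h2).add (h3.permAct fun y => σ y.1 s)).congr
      (Eventually.of_forall fun y => ?_)
    simp only [permAct_sub]
    ring
  | algebraMap c =>
    refine isNull_zero.congr (hpos.mono fun y hy => ?_)
    rw [Algebra.algebraMap_eq_smul_one, map_smul, map_smul, hy.1.map_one, hy.2.map_one, sub_self]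
  | add f g _ _ h1 h2 =>
    refine (h1.add h2).congr (Eventually.of_forall fun y => ?_)
    rw [map_add, map_add]
    ring
  | mul f g hf hg h1 h2 =>
    have h3 := (isNull_mul hq hf hg).comp (tendsto_pairFilter_fst (σ := σ) (q := q))
    have h4 := (isNull_mul hq hf hg).comp (tendsto_pairFilter_snd (σ := σ) (q := q))
    have h5 := h2.bdd_mul (norm_nonneg f) (hpos.mono fun y hy => hy.1.norm_apply_le f)
    have h6 := h1.bdd_mul (norm_nonneg g) (hpos.mono fun y hy => hy.2.norm_apply_le g)
    refine (((h3.sub h4).add h5).add h6).congr (Eventually.of_forall fun y => ?_)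
    ring

/-- A quantitative form of convergence along `pairFilter`, for finitely many elements. -/
theorem exists_uniform_separation (hq : IsRealUnitBallSeq q) {R : ℕ} {r : ℕ → LInfty μ}
    (hr : ∀ n, r n ∈ genAlg G q) {η : ℝ} (hη : 0 < η) :
    ∃ κ : ℝ, 0 < κ ∧ ∃ (F : Finset G) (m : ℕ) (δ : ℝ) (I : ℕ), F.Nonempty ∧ 1 ≤ m ∧ 0 < δ ∧
      ∀ i ≥ I, ∀ φ ψ : LInfty μ →ₗ[ℂ] (Fin (d i) → ℂ), IsUP q F m δ (σ i) φ →
        IsUP q F m δ (σ i) ψ → rho q φ ψ < κ → ∀ n < R, norm2 (φ (r n) - ψ (r n)) < η := by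
  have h : ∀ᶠ y in pairFilter σ q, ∀ n ∈ Set.Iio R, norm2 (y.2.1 (r n) - y.2.2 (r n)) < η :=
    (eventually_all_finite (Set.finite_Iio R)).2 fun n _ =>
      isNull_iff.1 (isNull_pair_sub hq (hr n)) η hη
  obtain ⟨S, hS, T, ⟨V, hV, hVT⟩, hST⟩ := mem_inf_iff_superset.1 h
  obtain ⟨S₁, ⟨A, hA, hAS⟩, S₂, ⟨B, hB, hBS⟩, hSS⟩ := mem_inf_iff_superset.1 hS
  obtain ⟨κ, hκ, hκV⟩ := Metric.mem_nhds_iff.1 hV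
  obtain ⟨F, m, δ, I, hF, hm, hδ, hI⟩ := eventually_upFilter_iff.1 (inter_mem hA hB)
  refine ⟨κ, hκ, F, m, δ, I, hF, hm, hδ, fun i hi φ ψ hφ hψ hρ => ?_⟩
  have hy := hST (a := ⟨i, φ, ψ⟩) ⟨hSS ⟨hAS (hI i hi φ hφ).1, hBS (hI i hi ψ hψ).2⟩,
    hVT (hκV (by rwa [Metric.mem_ball, Real.dist_0_eq_abs, abs_of_nonneg rho_nonneg]))⟩
  exact hy

end Pairs

/-! ### Comparison of entropies -/

section Comparison

theorem sepNumber_le_of_map {E E' : Type*} {ε ε' : ℝ} (hε' : 0 ≤ ε') {Y : Set E} {Y' : Set E'}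
    {ρ : E → E → ℝ} {ρ' : E' → E' → ℝ} (hρ' : ∀ x, ρ' x x = 0) (T : E → E')
    (hT : ∀ x ∈ Y, T x ∈ Y') (hsep : ∀ x ∈ Y, ∀ y ∈ Y, ε < ρ x y → ε' < ρ' (T x) (T y)) :
    sepNumber ε Y ρ ≤ sepNumber ε' Y' ρ' := by
  classical
  refine iSup₂_le fun L ⟨hLY, hL⟩ => ?_
  have hinj : Set.InjOn T L := by
    intro x hx y hy hxy
    by_contra hne
    have h := hsep x (hLY hx) y (hLY hy) (hL hx hy hne)
    rw [hxy, hρ'] at h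
    exact hε'.not_gt h
  rw [← Finset.card_image_of_injOn hinj]
  refine le_iSup₂_of_le (L.image T) ⟨?_, ?_⟩ le_rfl
  · rw [Finset.coe_image]
    exact Set.image_subset_iff.2 fun x hx => hT x (hLY hx)
  · rw [Finset.coe_image]
    rintro _ ⟨x, hx, rfl⟩ _ ⟨y, hy, rfl⟩ hne
    exact hsep x (hLY hx) y (hLY hy) (hL hx hy fun h => hne (h ▸ rfl))

variable {G X : Type*} [Group G] [MulAction G X] [MeasurableSpace X] [MeasurableConstSMul G X]
  {μ : Measure X} [SMulInvariantMeasure G X μ] {d : ℕ → ℕ} {σ : ∀ i, G → Equiv.Perm (Fin (d i))}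
  {p q : ℕ → LInfty μ} [IsProbabilityMeasure μ]

/-- The separation scale `ε'` is found first, from approximations of the first members of `p` in
the algebra of `q`; composition with a smoothing depending on all parameters then maps
`ε`-separated sets for `p` injectively to `ε'`-separated sets for `q`. -/
theorem entropy_le_entropy (hσ : IsSoficApproximation d σ) (hp : IsRealUnitBallSeq p)
    (hq : IsRealUnitBallSeq q) (hpgen : IsDynamicallyGenerating G (Set.range p))
    (hqgen : IsDynamicallyGenerating G (Set.range q)) : entropy σ p ≤ entropy σ q := by
  classical
  refine iSup₂_le fun ε hε => ?_
  obtain ⟨R, hR⟩ := exists_separating_index hp hε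
  choose r hr hpr using fun n => exists_genAlg_near hq hqgen (p n) (η := ε / 16) (by positivity)
  obtain ⟨κ, hκ, F₀, m₀, δ₀, I₀, hF₀, hm₀, hδ₀, hsep⟩ :=
    exists_uniform_separation (σ := σ) (R := R) hq hr (η := ε / 8) (by positivity)
  refine le_iSup₂_of_le (κ / 2) (half_pos hκ) ?_
  refine le_iInf₂ fun F₁ hF₁ => le_iInf₂ fun m₁ hm₁ => le_iInf₂ fun δ₁ hδ₁ => ?_
  obtain ⟨θ, hθ, hnear, hUP⟩ := exists_isSmoothing_isUP hσ hp hpgen hq (F₀ ∪ F₁) (max m₀ m₁)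
    (lt_min hδ₀ hδ₁) (Φ := r '' Set.Iio R) ((Set.finite_Iio R).image r) (η := ε / 16)
    (by positivity)
  have happrox : ∀ᶠ x in upFilter σ p, ∀ n ∈ Set.Iio R, norm2 (x.2 (p n - θ (r n))) < ε / 8 := by
    refine (eventually_all_finite (Set.finite_Iio R)).2 fun n hn => ?_
    refine eventually_norm2_lt hσ hp (sub_mem (seq_mem_genAlg p n) (hθ.mem _)) ?_
    rw [← sub_add_sub_cancel _ (r n), map_add]
    have h1 := hnear (r n) ⟨n, hn, rfl⟩
    rw [map_sub, norm_sub_rev, ← map_sub] at h1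
    exact (norm_add_le _ _).trans_lt (by linarith [hpr n])
  obtain ⟨F, m, δ, I, hF, hm, hδ, hI⟩ := eventually_upFilter_iff.1 (hUP.and happrox)
  refine iInf₂_le_of_le F hF (iInf₂_le_of_le m hm (iInf₂_le_of_le δ hδ ?_))
  refine limsup_le_limsup ?_
  filter_upwards [eventually_ge_atTop (max I I₀)] with i hi
  have hiI := (le_max_left _ _).trans hi
  refine EReal.div_le_div_right_of_nonneg (by exact_mod_cast (d i).cast_nonneg)
    (ENNReal.log_monotone (ENat.toENNReal_mono ?_))
  refine sepNumber_le_of_map (half_pos hκ).le (fun φ => rho_self) (fun φ => φ ∘ₗ θ)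
    (fun φ hφ => (hI i hiI φ hφ).1.mono Finset.subset_union_right (le_max_right _ _)
      (min_le_right _ _)) fun φ hφ ψ hψ hlt => ?_
  obtain ⟨n, hn, hlt⟩ := hR _ φ ψ hφ.unital_positive hψ.unital_positive hlt
  by_contra! hle
  have hφ' := hI i hiI φ hφ
  have hψ' := hI i hiI ψ hψ
  have h1 := hsep i ((le_max_right _ _).trans hi) (φ ∘ₗ θ) (ψ ∘ₗ θ)
    (hφ'.1.mono Finset.subset_union_left (le_max_left _ _) (min_le_left _ _))
    (hψ'.1.mono Finset.subset_union_left (le_max_left _ _) (min_le_left _ _))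
    (by linarith) n hn
  have h2 := hφ'.2 n hn
  have h3 := hψ'.2 n hn
  have h4 : φ (p n) - ψ (p n) = φ (p n - θ (r n)) + ((φ ∘ₗ θ) (r n) - (ψ ∘ₗ θ) (r n)) +
      -ψ (p n - θ (r n)) := by
    simp only [map_sub, LinearMap.comp_apply]
    ring
  have h5 := norm2_add_le (φ (p n - θ (r n)) + ((φ ∘ₗ θ) (r n) - (ψ ∘ₗ θ) (r n)))
    (-ψ (p n - θ (r n)))
  have h6 := norm2_add_le (φ (p n - θ (r n))) ((φ ∘ₗ θ) (r n) - (ψ ∘ₗ θ) (r n))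
  rw [← h4, norm2_neg] at h5
  simp only at h2 h3
  linarith

end Comparison

/-! ### Existence of generating sequences -/

section Existence

variable {X : Type*} [MeasurableSpace X] {μ : Measure X}

/-- Von Neumann subalgebras are closed under bounded almost everywhere convergence. -/
theorem IsVonNeumannSubalgebra.mem_of_tendsto {A : StarSubalgebra ℂ (LInfty μ)}
    (hA : IsVonNeumannSubalgebra A) {u : ℕ → LInfty μ} (hu : ∀ n, u n ∈ A) {C : ℝ}
    (hC : ∀ n, ∀ᵐ x ∂μ, ‖u n x‖ ≤ C) {f : LInfty μ}
    (hf : ∀ᵐ x ∂μ, Tendsto (fun n => u n x) atTop (𝓝 (f x))) : f ∈ A := by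
  have hlim : Tendsto u atTop (@nhds _ (weakStarTopology μ) f) := by
    rw [nhds_induced, tendsto_comap_iff, tendsto_pi_nhds]
    intro g
    refine tendsto_integral_of_dominated_convergence (fun x => C * ‖g x‖)
      (fun n => (Lp.aestronglyMeasurable _).mul (Lp.aestronglyMeasurable _))
      ((L1.integrable_coeFn g).norm.const_mul C) (fun n => ?_) ?_
    · filter_upwards [hC n] with x hx
      rw [norm_mul]
      gcongr
    · filter_upwards [hf] with x hx using hx.mul_const _
  exact @IsClosed.mem_of_tendsto _ (weakStarTopology μ) _ _ _ _ _ _ hA hlim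
    (Eventually.of_forall hu)

theorem ind_mul_ind {B C : Set X} (hB : MeasurableSet B) (hC : MeasurableSet C) :
    ind μ hB * ind μ hC = ind μ (hB.inter hC) := by
  ext1
  filter_upwards [coeFn_mul (ind μ hB) (ind μ hC), coeFn_ind (μ := μ) hB, coeFn_ind (μ := μ) hC,
    coeFn_ind (μ := μ) (hB.inter hC)] with x h1 h2 h3 h4
  rw [h1, h2, h3, h4]
  by_cases hxB : x ∈ B <;> by_cases hxC : x ∈ C <;> simp [hxB, hxC]

theorem one_sub_ind {B : Set X} (hB : MeasurableSet B) : 1 - ind μ hB = ind μ hB.compl := by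
  ext1
  filter_upwards [Lp.coeFn_sub 1 (ind μ hB), coeFn_one (μ := μ), coeFn_ind (μ := μ) hB,
    coeFn_ind (μ := μ) hB.compl] with x h1 h2 h3 h4
  rw [h1, Pi.sub_apply, h2, h3, h4]
  by_cases hxB : x ∈ B <;> simp [hxB]

/-- The sets whose indicator functions lie in a von Neumann subalgebra form a `σ`-algebra. -/
theorem ind_mem_of_generateFrom {A : StarSubalgebra ℂ (LInfty μ)} (hA : IsVonNeumannSubalgebra A)
    {𝒞 : Set (Set X)} (h𝒞 : ∀ B ∈ 𝒞, ∃ hB : MeasurableSet B, ind μ hB ∈ A) {B : Set X}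
    (hB : MeasurableSet[MeasurableSpace.generateFrom 𝒞] B) :
    ∃ hB : MeasurableSet B, ind μ hB ∈ A := by
  have hcompl : ∀ B : Set X, (∃ hB : MeasurableSet B, ind μ hB ∈ A) →
      ∃ hB : MeasurableSet Bᶜ, ind μ hB ∈ A := by
    rintro B ⟨hB, hBA⟩
    exact ⟨hB.compl, one_sub_ind (μ := μ) hB ▸ sub_mem (one_mem A) hBA⟩
  have hempty : ∃ hB : MeasurableSet (∅ : Set X), ind μ hB ∈ A := by
    refine ⟨MeasurableSet.empty, ?_⟩
    convert zero_mem A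
    ext1
    filter_upwards [coeFn_ind (μ := μ) (MeasurableSet.empty (α := X)),
      Lp.coeFn_zero ℂ ∞ μ] with x h1 h2
    rw [h1, h2]
    simp
  induction B, hB using MeasurableSpace.generateFrom_induction with
  | hC B hB _ => exact h𝒞 B hB
  | empty => exact hempty
  | compl B _ h => exact hcompl B h
  | iUnion s _ h =>
    have hunion : ∀ n, ∃ hB : MeasurableSet (⋂ i ∈ Finset.range n, (s i)ᶜ), ind μ hB ∈ A := by
      intro n
      induction n with
      | zero => simpa using hcompl ∅ hempty
      | succ n ih =>
        rw [Finset.range_add_one, Finset.set_biInter_insert]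
        obtain ⟨h1, h2⟩ := hcompl _ (h n)
        obtain ⟨h3, h4⟩ := ih
        exact ⟨h1.inter h3, ind_mul_ind (μ := μ) h1 h3 ▸ mul_mem h2 h4⟩
    choose hm hmem using hunion
    choose hs _ using h
    have hsU : MeasurableSet (⋂ i, (s i)ᶜ) := MeasurableSet.iInter fun i => (hs i).compl
    have hU : ind μ hsU ∈ A := by
      refine hA.mem_of_tendsto hmem (C := 1) (fun n => ?_) ?_
      · filter_upwards [coeFn_ind (μ := μ) (hm n)] with x hx
        rw [hx]
        by_cases hxB : x ∈ ⋂ i ∈ Finset.range n, (s i)ᶜ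
        · rw [Set.indicator_of_mem hxB, norm_one]
        · rw [Set.indicator_of_notMem hxB, norm_zero]
          exact zero_le_one
      · have h1 : ∀ᵐ x ∂μ, ∀ n, ind μ (hm n) x =
            (⋂ i ∈ Finset.range n, (s i)ᶜ).indicator (fun _ => (1 : ℂ)) x :=
          ae_all_iff.2 fun n => coeFn_ind (μ := μ) (hm n)
        filter_upwards [h1, coeFn_ind (μ := μ) hsU] with x h1 h2
        rw [h2]
        simp only [h1]
        by_cases hx : x ∈ ⋂ i, (s i)ᶜ
        · rw [Set.indicator_of_mem hx]
          refine tendsto_const_nhds.congr fun n => (Set.indicator_of_mem ?_ _).symm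
          exact Set.mem_iInter₂.2 fun i _ => Set.mem_iInter.1 hx i
        · rw [Set.indicator_of_notMem hx]
          obtain ⟨i, hi⟩ := not_forall.1 fun h => hx (Set.mem_iInter.2 h)
          refine tendsto_const_nhds.congr' ?_
          filter_upwards [eventually_gt_atTop i] with n hn
          exact (Set.indicator_of_notMem
            (fun h => hi (Set.mem_iInter₂.1 h i (Finset.mem_range.2 hn))) _).symm
    have := hcompl _ ⟨hsU, hU⟩
    rwa [Set.compl_iInter, Set.iUnion_congr fun i => compl_compl (s i)] at this

/-- A von Neumann subalgebra that contains all indicator functions is everything. -/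
theorem eq_top_of_ind_mem {A : StarSubalgebra ℂ (LInfty μ)} (hA : IsVonNeumannSubalgebra A)
    (hind : ∀ (B : Set X) (hB : MeasurableSet B), ind μ hB ∈ A) : A = ⊤ := by
  refine eq_top_iff.2 fun f _ => ?_
  have hsimple : ∀ g : SimpleFunc X ℂ, ∃ u ∈ A, ⇑u =ᵐ[μ] g := by
    intro g
    refine ⟨∑ c ∈ g.range, c • ind μ (g.measurableSet_fiber c),
      sum_mem fun c _ => SMulMemClass.smul_mem c (hind _ _), ?_⟩
    have h1 : ∀ᵐ x ∂μ, ∀ c ∈ g.range, (c • ind μ (g.measurableSet_fiber c) : LInfty μ) x =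
        if g x = c then c else 0 := by
      refine (eventually_all_finset _).2 fun c _ => ?_
      filter_upwards [Lp.coeFn_smul c (ind μ (g.measurableSet_fiber c)),
        coeFn_ind (μ := μ) (g.measurableSet_fiber c)] with x h1 h2
      rw [h1, Pi.smul_apply, h2]
      by_cases h : g x = c <;> simp [h]
    filter_upwards [h1, ae_coeFn_sum g.range fun c => c • ind μ (g.measurableSet_fiber c)]
      with x h1 h2
    rw [h2, Finset.sum_congr rfl h1, Finset.sum_ite_eq, if_pos (g.mem_range_self x)]
  have hfm := Lp.stronglyMeasurable f
  choose u huA hu using fun n => hsimple (hfm.approxBounded ‖f‖ n)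
  refine hA.mem_of_tendsto huA (C := ‖f‖) (fun n => ?_) ?_
  · filter_upwards [hu n] with x hx
    rw [hx]
    exact hfm.norm_approxBounded_le (norm_nonneg _) n x
  · have h1 : ∀ᵐ x ∂μ, ∀ n, u n x = hfm.approxBounded ‖f‖ n x := ae_all_iff.2 hu
    filter_upwards [h1, hfm.tendsto_approxBounded_ae (ae_norm_le_norm f)] with x h1 h2
    simpa only [h1] using h2

/-- The indicator functions of a countable family generating the Borel structure form a
dynamically generating sequence. -/
theorem exists_generating_sequence {G : Type*} [Group G] [MulAction G X] [MeasurableConstSMul G X]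
    [SMulInvariantMeasure G X μ] [MeasurableSpace.CountablyGenerated X] :
    ∃ p : ℕ → LInfty μ, IsRealUnitBallSeq p ∧ IsDynamicallyGenerating G (Set.range p) := by
  have hm := MeasurableSpace.measurableSet_natGeneratingSequence (α := X)
  refine ⟨fun n => ind μ (hm n), fun n => ⟨?_, ?_⟩, fun A hA _ hsub => ?_⟩
  · refine norm_le_of_ae_norm_le zero_le_one ?_
    filter_upwards [coeFn_ind (μ := μ) (hm n)] with x hx
    rw [hx]
    by_cases h : x ∈ MeasurableSpace.natGeneratingSequence X n <;> simp [h]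
  · filter_upwards [coeFn_ind (μ := μ) (hm n)] with x hx
    rw [hx]
    by_cases h : x ∈ MeasurableSpace.natGeneratingSequence X n <;> simp [h]
  · refine eq_top_of_ind_mem hA fun B hB => ?_
    rw [← MeasurableSpace.generateFrom_natGeneratingSequence X] at hB
    obtain ⟨hB', hmem⟩ := ind_mem_of_generateFrom hA
      (by rintro _ ⟨n, rfl⟩; exact ⟨hm n, hsub ⟨n, rfl⟩⟩) hB
    exact hmem

end Existence

end

end SoficEntropy

theorem mainTheorem2 {G X : Type*} [Group G] [Countable G] [MeasurableSpace X]
    [StandardBorelSpace X] [MulAction G X] [MeasurableConstSMul G X]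
    (μ : Measure X) [IsProbabilityMeasure μ] [SMulInvariantMeasure G X μ]
    (d : ℕ → ℕ) (σ : ∀ i, G → Equiv.Perm (Fin (d i)))
    (hσ : SoficEntropy.IsSoficApproximation d σ) :
    (∀ p q : ℕ → SoficEntropy.LInfty μ,
      SoficEntropy.IsRealUnitBallSeq p → SoficEntropy.IsRealUnitBallSeq q →
      SoficEntropy.IsDynamicallyGenerating G (Set.range p) →
      SoficEntropy.IsDynamicallyGenerating G (Set.range q) →
      SoficEntropy.entropy σ q = SoficEntropy.entropy σ p) ∧
    ∃! h : EReal, SoficEntropy.IsGlobalEntropy μ σ h := by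
  have hinv : ∀ p q : ℕ → SoficEntropy.LInfty μ,
      SoficEntropy.IsRealUnitBallSeq p → SoficEntropy.IsRealUnitBallSeq q →
      SoficEntropy.IsDynamicallyGenerating G (Set.range p) →
      SoficEntropy.IsDynamicallyGenerating G (Set.range q) →
      SoficEntropy.entropy σ q = SoficEntropy.entropy σ p := fun p q hp hq hpg hqg =>
    (SoficEntropy.entropy_le_entropy hσ hq hp hqg hpg).antisymm
      (SoficEntropy.entropy_le_entropy hσ hp hq hpg hqg)
  refine ⟨hinv, ?_⟩
  obtain ⟨p, hp, hpg⟩ := SoficEntropy.exists_generating_sequence (G := G) (μ := μ)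
  exact ⟨SoficEntropy.entropy σ p,
    ⟨⟨p, hp, hpg⟩, fun q hq hqg => hinv p q hp hq hpg hqg⟩, fun h hh => (hh.2 p hp hpg).symm⟩
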